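/- Fix $k\ge 1$ and $\vec p=(p_1,\dots,p_k)$ with all $p_i>0$ and $\sum_i p_i=1$. *Token games.* For $n\in\mathbb N$, a pure strategy of $n$-token competitive Knock 'em Down is an allocation $\vec\xi\in\mathbb Z_{\ge 0}^k$ with $\sum_i\xi_i=n$ (put $\xi_i$ tokens into bin $i$). A $k$-sided die that shows side $i$ with probability $p_i$ is thrown repeatedly and independently; each throw showing $i$ removes one token from bin $i$, if there is one. The same throws are used for both players. Let $T_{\vec\xi}$ be the number of throws after which all tokens of $\vec\xi$ are removed, and let $$K_n(\vec\xi,\vec\eta)=\tfrac12\bigl(\Pr[T_{\vec\xi}<T_{\vec\eta}]-\Pr[T_{\vec\eta}<T_{\vec\xi}]\bigr).$$ A mixed strategy $\alpha$ is a probability measure on allocations, and $K_n(\alpha,\vec\eta)=\int K_n(\vec\xi,\vec\eta)\,\alpha(d\vec\xi)$. *Continuous game.* A pure strategy is a vector $\vec x\in\mathbb R^k$ with $\sum_i x_i=0$, and a mixed strategy is a Borel probability measure on the set of these vectors. With $Z_1,\dots,Z_k$ independent standard normal variables (the same for both players), let $$T_{\vec x}=\max_i\Bigl(\frac{x_i}{p_i}+\frac{Z_i}{\sqrt{p_i}}\Bigr),\qquad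 K(\vec x,\vec y)=\tfrac12\bigl(\Pr[T_{\vec x}<T_{\vec y}]-\Pr[T_{\vec y}<T_{\vec x}]\bigr),$$ and $K(\alpha,\beta)=\iint K(\vec x,\vec y)\,\alpha(d\vec x)\,\beta(d\vec y)$. A mixed strategy $\alpha$ is *optimal* if $K(\beta,\alpha)\le 0$ for every mixed strategy $\beta$. **Corollary 4.3.** For each $n$ let $\alpha_n$ be a mixed strategy of the $n$-token game, regarded for $n\ge1$ also as a probability measure on vectors $\vec x$ with vanishing sum through the normalization $\xi_i=p_i n+x_i\sqrt n$. If, as $n\to\infty$, these normalized measures converge weakly to a mixed strategy $\alpha_0$ that is optimal for the continuous game, then $(\alpha_n)$ is asymptotically optimal for the $n$-token games, that is, $$\kappa_n:=\min_{\vec\eta}K_n(\alpha_n,\vec\eta)\longrightarrow 0\qquad(n\to\infty),$$ where the minimum is over all allocations $\vec\eta$ of $n$ tokens. -/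

import Mathlib

open MeasureTheory ProbabilityTheory Filter Topology

namespace KnockEmDown

/-- A `k`-sided die: side `i` comes up with probability `prob i > 0`. -/
structure Die (k : ℕ) where
  prob : Fin k → ℝ
  prob_pos : ∀ i, 0 < prob i
  sum_prob : ∑ i, prob i = 1

/-- The law of one throw of the die. -/
noncomputable def Die.law {k : ℕ} (d : Die k) : Measure (Fin k) :=
  ∑ i, ENNReal.ofReal (d.prob i) • Measure.dirac i

instance Die.isProbabilityMeasure_law {k : ℕ} (d : Die k) : IsProbabilityMeasure d.law := by
  constructor
  simp only [Die.law, Measure.coe_finsetSum, Finset.sum_apply, Measure.smul_apply, measure_univ,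
    smul_eq_mul, mul_one]
  rw [← ENNReal.ofReal_sum_of_nonneg (fun i _ => (d.prob_pos i).le), d.sum_prob,
    ENNReal.ofReal_one]

/-- The law of an infinite sequence of independent throws of the die. -/
noncomputable def Die.throws {k : ℕ} (d : Die k) : Measure (ℕ → Fin k) :=
  Measure.infinitePi (fun _ : ℕ => d.law)

/-! ### The `n`-token game -/

/-- The pure strategies of the `n`-token game: `ξ i` tokens are put into bin `i`. -/
abbrev Allocation (k n : ℕ) : Type := {ξ : Fin k → ℕ // ∑ i, ξ i = n}

instance Allocation.instFinite (k n : ℕ) : Finite (Allocation k n) := by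
  refine Finite.of_injective
    (fun (ξ : Allocation k n) (i : Fin k) => (⟨ξ.1 i, ?_⟩ : Fin (n + 1))) ?_
  · have h : ξ.1 i ≤ ∑ j, ξ.1 j :=
      Finset.single_le_sum (f := ξ.1) (fun _ _ => Nat.zero_le _) (Finset.mem_univ i)
    have h2 := ξ.2
    omega
  · intro ξ η h
    ext i
    simpa using congrFun h i

/-- The number of tokens left in bin `i` after the first `t` throws; each throw showing `i` removes
one token from bin `i`, if there is one. -/
def tokensLeft {k : ℕ} (ξ : Fin k → ℕ) (ω : ℕ → Fin k) : ℕ → Fin k → ℕ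
  | 0, i => ξ i
  | t + 1, i => if ω t = i then tokensLeft ξ ω t i - 1 else tokensLeft ξ ω t i

/-- The number of throws needed to knock down all tokens (`⊤` if this never happens). -/
noncomputable def tokenClearanceTime {k : ℕ} (ξ : Fin k → ℕ) (ω : ℕ → Fin k) : ℕ∞ :=
  ⨅ t ∈ {t : ℕ | ∀ i, tokensLeft ξ ω t i = 0}, (t : ℕ∞)

/-- The payoff `K_n(ξ, η)` of the `n`-token game for pure strategies; both players' tokens are
knocked down by the same throws, and the player whose tokens are cleared first wins. -/
noncomputable def tokenPayoff {k n : ℕ} (d : Die k) (ξ η : Allocation k n) : ℝ :=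
  (d.throws.real {ω | tokenClearanceTime ξ.1 ω < tokenClearanceTime η.1 ω} -
    d.throws.real {ω | tokenClearanceTime η.1 ω < tokenClearanceTime ξ.1 ω}) / 2

/-- The payoff `K_n(α, η)` of a mixed strategy `α` against a pure strategy `η`. -/
noncomputable def tokenMixedPayoff {k n : ℕ} (d : Die k)
    (α : ProbabilityMeasure (Allocation k n)) (η : Allocation k n) : ℝ :=
  ∫ ξ, tokenPayoff d ξ η ∂(α : Measure (Allocation k n))

/-- `κ_n = min_η K_n(α, η)`, the worst-case payoff of the mixed strategy `α`. -/
noncomputable def worstPayoff {k n : ℕ} (d : Die k)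
    (α : ProbabilityMeasure (Allocation k n)) : ℝ :=
  ⨅ η : Allocation k n, tokenMixedPayoff d α η

/-- The worst-case payoff is an attained minimum. -/
theorem worstPayoff_isLeast {k n : ℕ} (d : Die k) (α : ProbabilityMeasure (Allocation k n)) :
    IsLeast (Set.range (tokenMixedPayoff d α)) (worstPayoff d α) := by
  have : Nonempty (Allocation k n) := α.nonempty
  refine ⟨?_, ?_⟩
  · obtain ⟨η, hη⟩ := exists_eq_ciInf_of_finite (f := tokenMixedPayoff d α)
    exact ⟨η, hη⟩
  · rintro _ ⟨η, rfl⟩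
    exact ciInf_le (Set.finite_range _).bddBelow η

/-- A sequence of mixed strategies for the `n`-token games is asymptotically optimal if its
worst-case payoffs tend to `0`. -/
def IsAsymptoticallyOptimal {k : ℕ} (d : Die k)
    (α : (n : ℕ) → ProbabilityMeasure (Allocation k n)) : Prop :=
  Tendsto (fun n => worstPayoff d (α n)) atTop (𝓝 0)

/-! ### The continuous game -/

/-- The pure strategies of the continuous game: real vectors with vanishing sum. -/
abbrev Deviation (k : ℕ) : Type := {x : Fin k → ℝ // ∑ i, x i = 0}

/-- The clearance time `max_i (x_i / p_i + z_i / √p_i)`. -/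
noncomputable def clearanceTime {k : ℕ} (d : Die k) (x z : Fin k → ℝ) : ℝ :=
  ⨆ i, (x i / d.prob i + z i / √(d.prob i))

/-- The law of `k` independent standard normal variables. -/
noncomputable def stdNormals (k : ℕ) : Measure (Fin k → ℝ) :=
  Measure.pi (fun _ => gaussianReal 0 1)

/-- The payoff `K(x, y)` of the continuous game for pure strategies. -/
noncomputable def payoff {k : ℕ} (d : Die k) (x y : Deviation k) : ℝ :=
  ((stdNormals k).real {z | clearanceTime d x.1 z < clearanceTime d y.1 z} -
    (stdNormals k).real {z | clearanceTime d y.1 z < clearanceTime d x.1 z}) / 2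

/-- The payoff `K(α, β)` of the continuous game for mixed strategies. -/
noncomputable def mixedPayoff {k : ℕ} (d : Die k) (α β : ProbabilityMeasure (Deviation k)) : ℝ :=
  ∫ y, ∫ x, payoff d x y ∂(α : Measure (Deviation k)) ∂(β : Measure (Deviation k))

/-- `α` dominates `β` if `K(α, β) > 0`. -/
def Dominates {k : ℕ} (d : Die k) (α β : ProbabilityMeasure (Deviation k)) : Prop :=
  0 < mixedPayoff d α β

/-- A mixed strategy of the continuous game is optimal if no mixed strategy dominates it. -/
def IsOptimal {k : ℕ} (d : Die k) (α : ProbabilityMeasure (Deviation k)) : Prop :=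
  ∀ β : ProbabilityMeasure (Deviation k), ¬ Dominates d β α

/-! ### Token strategies on the scale of the continuous game -/

/-- The vector `x` with `ξ_i = p_i n + x_i √n` (for `n = 0`, the zero vector). -/
noncomputable def rescale {k n : ℕ} (d : Die k) (ξ : Allocation k n) : Deviation k :=
  ⟨fun i => ((ξ.1 i : ℝ) - d.prob i * n) / √n, by
    rw [← Finset.sum_div, Finset.sum_sub_distrib, ← Finset.sum_mul, d.sum_prob,
      ← Nat.cast_sum, ξ.2]
    simp⟩

/-- A mixed strategy of the `n`-token game, as a probability measure on rescaled allocations. -/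
noncomputable def rescaledStrategy {k n : ℕ} (d : Die k)
    (α : ProbabilityMeasure (Allocation k n)) : ProbabilityMeasure (Deviation k) :=
  α.map (f := rescale d) (measurable_of_countable _).aemeasurable

end KnockEmDown

/-!
The payoffs of both games are governed by the bin that is cleared last. If `ζ` is the
coordinatewise maximum of two allocations `ξ` and `η`, and the last token of `ζ` to be removed
lies in bin `i`, then `ξ` wins, loses or ties according as `ξ i` is less than, greater than or
equal to `η i`. Hence `K_n(ξ, η) = ½ ∑ i, sign (η i - ξ i) * R_i(ξ ⊔ η)`, where `R_i(ζ)` is the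
probability that bin `i` is the last one (`tokenPayoff_eq`), and likewise `K(x, y) = ½ ∑ i, sign
(y i - x i) * Q_i(x ⊔ y)`, where `Q_i(w)` is the probability that `w j / p j + Z j / √(p j)` is
largest for `j = i` (`payoff_eq`).

Only the order of the throws matters for `R_i`, so they may be placed at the points of a Poisson
process. Then the bins are independent and their clearance times have Erlang laws, which makes
`R_i` an explicit integral, `lastBinProb`. That it describes the throws of the die follows by
first-step analysis: both sides satisfy the same recursion (`measureReal_clearedFirst_eq`). By
Stirling's formula the Erlang densities converge to Gaussian ones on the scale of the continuous
game (`tendsto_erlangPDF_gaussian`), and with Scheffé's lemma `R_i → Q_i` (`tendsto_lastBinProb`).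

So `K_n(ξ_n, η_n) → K(x, y)` whenever the rescaled allocations converge to `x` and `y` with `x i ≠
y i` for all `i`. The payoff `K` is discontinuous where coordinates agree, and here optimality of
`α₀` enters. Moving a best reply `y` infinitesimally in a direction `v` with vanishing sum changes
its payoff by the tie probabilities of the bins, weighted with the signs of `v`. As no move may be
profitable, all tie probabilities agree, and for three or more bins the choice of one positive and
two negative entries of `v` forces them to vanish: the coordinates of `α₀` have no atoms
(`IsOptimal.measure_coord_eq_zero`). For two bins `α₀` may have an atom, but then both bins are
equally likely to be last there (`IsOptimal.argmaxProb_eq_of_atom`), and the token payoffs near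
the atom tend to `0`. For one bin all payoffs vanish.

If the worst-case payoffs stayed below some `c < 0` along a subsequence, the best replies would
have a further subsequence whose rescaled allocations converge to some `y` or have a coordinate
tending to `+∞`. In the first case a lower bound for integrals under weak convergence
(`integral_le_of_tendsto_of_forall_lt`) gives `0 ≤ K(α₀, y) ≤ c`; in the second the replies do not
win in the limit (`eventually_lt_tokenPayoff_of_tendsto_atTop`). Both are absurd. That the
worst-case payoffs are at most `0` is the antisymmetry of `K_n`.
-/

namespace KnockEmDown

variable {k : ℕ}

/-! ### Erlang distributions -/

/-- The probability that a Poisson variable of mean `u` equals `m`. -/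
noncomputable def poissonWeight (m : ℕ) (u : ℝ) : ℝ :=
  Real.exp (-u) * u ^ m / m.factorial

/-- The density, on `t ≥ 0`, of the time of the `m`-th point of a Poisson process of rate `p`.
For `m = 0` the law is a point mass at `0`, and the value is `0`. -/
noncomputable def erlangPDF (p : ℝ) : ℕ → ℝ → ℝ
  | 0, _ => 0
  | m + 1, t => p * poissonWeight m (p * t)

/-- The distribution function, on `t ≥ 0`, of the time of the `m`-th point of a Poisson process of
rate `p`; it is constantly `1` for `m = 0`. -/
noncomputable def erlangCDF (p : ℝ) (m : ℕ) (t : ℝ) : ℝ :=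
  1 - ∑ l ∈ Finset.range m, poissonWeight l (p * t)

lemma poissonWeight_nonneg (m : ℕ) {u : ℝ} (hu : 0 ≤ u) : 0 ≤ poissonWeight m u := by
  unfold poissonWeight; positivity

lemma hasDerivAt_poissonWeight_zero (u : ℝ) :
    HasDerivAt (poissonWeight 0) (-poissonWeight 0 u) u := by
  have h := ((hasDerivAt_id u).neg).exp
  have hf : poissonWeight 0 = fun x => Real.exp (-x) := by
    funext x
    simp [poissonWeight]
  rw [hf]
  simpa using h

lemma hasDerivAt_poissonWeight_succ (m : ℕ) (u : ℝ) :
    HasDerivAt (poissonWeight (m + 1)) (poissonWeight m u - poissonWeight (m + 1) u) u := by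
  have h := ((((hasDerivAt_id u).neg).exp).mul (hasDerivAt_pow (m + 1) u)).div_const
    ((m + 1).factorial : ℝ)
  refine h.congr_deriv ?_
  simp only [poissonWeight, Nat.factorial_succ, id, Pi.neg_apply]
  push_cast
  have : (m.factorial : ℝ) ≠ 0 := by positivity
  have : (m : ℝ) + 1 ≠ 0 := by positivity
  field_simp
  ring

lemma tendsto_poissonWeight (m : ℕ) : Tendsto (poissonWeight m) atTop (𝓝 0) := by
  have h := (Real.tendsto_pow_mul_exp_neg_atTop_nhds_zero m).div_const (m.factorial : ℝ)
  simp only [zero_div] at h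
  refine h.congr fun u => ?_
  rw [poissonWeight, mul_comm]

lemma erlangPDF_nonneg {p : ℝ} (hp : 0 ≤ p) (m : ℕ) {t : ℝ} (ht : 0 ≤ t) :
    0 ≤ erlangPDF p m t := by
  cases m with
  | zero => exact le_rfl
  | succ m => exact mul_nonneg hp (poissonWeight_nonneg m (mul_nonneg hp ht))

lemma erlangPDF_eq (p : ℝ) (m : ℕ) (t : ℝ) :
    erlangPDF p m t = p * (erlangCDF p (m - 1) t - erlangCDF p m t) := by
  cases m with
  | zero => simp [erlangPDF]
  | succ m =>
    simp only [erlangPDF, erlangCDF, Nat.add_sub_cancel, Finset.sum_range_succ]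
    ring

lemma hasDerivAt_erlangPDF (p : ℝ) (m : ℕ) (t : ℝ) :
    HasDerivAt (erlangPDF p m) (p * (erlangPDF p (m - 1) t - erlangPDF p m t)) t := by
  have hlin : HasDerivAt (fun t => p * t) p t := by
    simpa using (hasDerivAt_id t).const_mul p
  match m with
  | 0 => exact (hasDerivAt_const t (0 : ℝ)).congr_deriv (by simp [erlangPDF])
  | 1 =>
    have h := ((hasDerivAt_poissonWeight_zero (p * t)).comp t hlin).const_mul p
    refine h.congr_deriv ?_
    simp only [erlangPDF, Nat.sub_self]
    ring
  | m + 2 =>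
    have h := ((hasDerivAt_poissonWeight_succ m (p * t)).comp t hlin).const_mul p
    refine h.congr_deriv ?_
    simp only [erlangPDF, Nat.add_succ_sub_one]
    ring

lemma hasDerivAt_erlangCDF (p : ℝ) (m : ℕ) (t : ℝ) :
    HasDerivAt (erlangCDF p m) (erlangPDF p m t) t := by
  have hlin : HasDerivAt (fun t => p * t) p t := by
    simpa using (hasDerivAt_id t).const_mul p
  induction m with
  | zero =>
    have h : erlangCDF p 0 = fun _ => 1 := funext fun t => by simp [erlangCDF]
    rw [h]
    exact hasDerivAt_const t 1
  | succ m ih =>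
    have hstep : erlangCDF p (m + 1) = fun t => erlangCDF p m t - poissonWeight m (p * t) := by
      funext t
      simp only [erlangCDF, Finset.sum_range_succ]
      ring
    rw [hstep]
    cases m with
    | zero =>
      refine (ih.sub ((hasDerivAt_poissonWeight_zero (p * t)).comp t hlin)).congr_deriv ?_
      simp only [erlangPDF]
      ring
    | succ m =>
      refine (ih.sub ((hasDerivAt_poissonWeight_succ m (p * t)).comp t hlin)).congr_deriv ?_
      simp only [erlangPDF]
      ring

lemma continuous_erlangPDF (p : ℝ) (m : ℕ) : Continuous (erlangPDF p m) :=
  continuous_iff_continuousAt.2 fun t => (hasDerivAt_erlangPDF p m t).continuousAt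

lemma continuous_erlangCDF (p : ℝ) (m : ℕ) : Continuous (erlangCDF p m) :=
  continuous_iff_continuousAt.2 fun t => (hasDerivAt_erlangCDF p m t).continuousAt

lemma erlangCDF_antitone {p : ℝ} (hp : 0 ≤ p) {t : ℝ} (ht : 0 ≤ t) :
    Antitone fun m => erlangCDF p m t := by
  refine antitone_nat_of_succ_le fun m => ?_
  have := poissonWeight_nonneg m (mul_nonneg hp ht)
  simp only [erlangCDF, Finset.sum_range_succ]
  linarith

lemma erlangCDF_zero (p t : ℝ) : erlangCDF p 0 t = 1 := by simp [erlangCDF]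

lemma erlangCDF_le_one {p : ℝ} (hp : 0 ≤ p) (m : ℕ) {t : ℝ} (ht : 0 ≤ t) :
    erlangCDF p m t ≤ 1 :=
  (erlangCDF_antitone hp ht (Nat.zero_le m)).trans_eq (erlangCDF_zero p t)

lemma erlangCDF_nonneg {p : ℝ} (hp : 0 ≤ p) (m : ℕ) {t : ℝ} (ht : 0 ≤ t) :
    0 ≤ erlangCDF p m t := by
  have h := Real.sum_le_exp_of_nonneg (mul_nonneg hp ht) m
  have h2 : ∑ l ∈ Finset.range m, poissonWeight l (p * t)
      = Real.exp (-(p * t)) * ∑ l ∈ Finset.range m, (p * t) ^ l / l.factorial := by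
    rw [Finset.mul_sum]
    exact Finset.sum_congr rfl fun l _ => by rw [poissonWeight, mul_div_assoc]
  have h3 : Real.exp (-(p * t)) * Real.exp (p * t) = 1 := by
    rw [← Real.exp_add]; simp
  have h4 := mul_le_mul_of_nonneg_left h (Real.exp_pos (-(p * t))).le
  rw [erlangCDF, h2]
  linarith

lemma erlangCDF_at_zero (p : ℝ) {m : ℕ} (hm : m ≠ 0) : erlangCDF p m 0 = 0 := by
  obtain ⟨m, rfl⟩ := Nat.exists_eq_succ_of_ne_zero hm
  simp [erlangCDF, Finset.sum_range_succ', poissonWeight]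

lemma erlangPDF_at_zero (p : ℝ) {m : ℕ} (hm : m ≠ 1) : erlangPDF p m 0 = 0 := by
  match m with
  | 0 => rfl
  | 1 => exact absurd rfl hm
  | m + 2 => simp [erlangPDF, poissonWeight]

lemma tendsto_erlangPDF {p : ℝ} (hp : 0 < p) (m : ℕ) :
    Tendsto (erlangPDF p m) atTop (𝓝 0) := by
  cases m with
  | zero => exact tendsto_const_nhds
  | succ m =>
    have h := ((tendsto_poissonWeight m).comp (tendsto_id.const_mul_atTop hp)).const_mul p
    rw [mul_zero] at h
    exact h

lemma tendsto_erlangCDF {p : ℝ} (hp : 0 < p) (m : ℕ) :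
    Tendsto (erlangCDF p m) atTop (𝓝 1) := by
  have h : Tendsto (fun t => ∑ l ∈ Finset.range m, poissonWeight l (p * t)) atTop
      (𝓝 (∑ _l ∈ Finset.range m, (0 : ℝ))) :=
    tendsto_finsetSum _ fun l _ =>
      (tendsto_poissonWeight l).comp (tendsto_id.const_mul_atTop hp)
  have h2 := (tendsto_const_nhds (x := (1 : ℝ))).sub h
  simp only [Finset.sum_const_zero, sub_zero] at h2
  exact h2

lemma integrableOn_erlangPDF {p : ℝ} (hp : 0 < p) (m : ℕ) :
    IntegrableOn (erlangPDF p m) (Set.Ioi 0) :=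
  integrableOn_Ioi_deriv_of_nonneg' (fun t _ => hasDerivAt_erlangCDF p m t)
    (fun _ ht => erlangPDF_nonneg hp.le m (le_of_lt ht)) (tendsto_erlangCDF hp m)

lemma integral_erlangPDF {p : ℝ} (hp : 0 < p) {m : ℕ} (hm : m ≠ 0) :
    ∫ t in Set.Ioi 0, erlangPDF p m t = 1 := by
  rw [integral_Ioi_of_hasDerivAt_of_nonneg' (fun t _ => hasDerivAt_erlangCDF p m t)
    (fun _ ht => erlangPDF_nonneg hp.le m (le_of_lt ht)) (tendsto_erlangCDF hp m),
    erlangCDF_at_zero p hm, sub_zero]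

lemma integral_erlangPDF_Ioc {p : ℝ} {m : ℕ} (hm : m ≠ 0) {t : ℝ} (ht : 0 ≤ t) :
    ∫ u in Set.Ioc 0 t, erlangPDF p m u = erlangCDF p m t := by
  rw [← intervalIntegral.integral_of_le ht,
    intervalIntegral.integral_eq_sub_of_hasDerivAt (fun u _ => hasDerivAt_erlangCDF p m u)
      ((continuous_erlangPDF p m).intervalIntegrable _ _), erlangCDF_at_zero p hm, sub_zero]

/-! ### The Poissonised race between the bins -/


/-- The probability that bin `i` is the last to be cleared of `ζ i` tokens when the hits of the bins
`j` are independent Poisson processes of rates `d.prob j`: the integral over the clearance time of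
bin `i` of its density times the probabilities that the other bins have been cleared. -/
noncomputable def lastBinProb (d : Die k) (ζ : Fin k → ℕ) (i : Fin k) : ℝ :=
  ∫ t in Set.Ioi 0, ∏ j, if j = i then erlangPDF (d.prob j) (ζ j) t
    else erlangCDF (d.prob j) (ζ j) t

lemma lastBinProb_eq (d : Die k) (ζ : Fin k → ℕ) (i : Fin k) :
    lastBinProb d ζ i = ∫ t in Set.Ioi 0, erlangPDF (d.prob i) (ζ i) t *
      ∏ j ∈ Finset.univ.erase i, erlangCDF (d.prob j) (ζ j) t := by
  refine setIntegral_congr_fun measurableSet_Ioi fun t _ => ?_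
  rw [← Finset.mul_prod_erase _ _ (Finset.mem_univ i), if_pos rfl]
  congr 1
  exact Finset.prod_congr rfl fun j hj => if_neg (Finset.ne_of_mem_erase hj)

lemma prod_erlangCDF_mem (d : Die k) (ζ : Fin k → ℕ) (s : Finset (Fin k)) {t : ℝ} (ht : 0 ≤ t) :
    ∏ j ∈ s, erlangCDF (d.prob j) (ζ j) t ∈ Set.Icc (0 : ℝ) 1 :=
  ⟨Finset.prod_nonneg fun j _ => erlangCDF_nonneg (d.prob_pos j).le _ ht,
    Finset.prod_le_one (fun j _ => erlangCDF_nonneg (d.prob_pos j).le _ ht)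
      fun j _ => erlangCDF_le_one (d.prob_pos j).le _ ht⟩

lemma lastBinProb_nonneg (d : Die k) (ζ : Fin k → ℕ) (i : Fin k) : 0 ≤ lastBinProb d ζ i := by
  rw [lastBinProb_eq]
  exact setIntegral_nonneg measurableSet_Ioi fun t ht =>
    mul_nonneg (erlangPDF_nonneg (d.prob_pos i).le _ (le_of_lt ht))
      (prod_erlangCDF_mem d ζ _ (le_of_lt ht)).1

lemma lastBinProb_of_eq_zero (d : Die k) {ζ : Fin k → ℕ} {i : Fin k} (h : ζ i = 0) :
    lastBinProb d ζ i = 0 := by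
  rw [lastBinProb_eq]
  simp [h, erlangPDF]

lemma integrableOn_lastBin (d : Die k) (ζ : Fin k → ℕ) (i : Fin k) :
    IntegrableOn (fun t => ∏ j, if j = i then erlangPDF (d.prob j) (ζ j) t
      else erlangCDF (d.prob j) (ζ j) t) (Set.Ioi 0) := by
  have h : IntegrableOn (fun t => (∏ j ∈ Finset.univ.erase i, erlangCDF (d.prob j) (ζ j) t) *
      erlangPDF (d.prob i) (ζ i) t) (Set.Ioi 0) := by
    refine Integrable.bdd_mul (c := 1) (integrableOn_erlangPDF (d.prob_pos i) (ζ i)) ?_ ?_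
    · exact (continuous_finsetProd _ fun j _ =>
        continuous_erlangCDF (d.prob j) (ζ j)).aestronglyMeasurable
    · refine (ae_restrict_iff' measurableSet_Ioi).2 (.of_forall fun t ht => ?_)
      have := prod_erlangCDF_mem d ζ (Finset.univ.erase i) (le_of_lt ht)
      rw [Real.norm_eq_abs, abs_of_nonneg this.1]
      exact this.2
  refine h.congr_fun (fun t _ => ?_) measurableSet_Ioi
  beta_reduce
  rw [← Finset.mul_prod_erase _ _ (Finset.mem_univ i), if_pos rfl, mul_comm]
  congr 1
  exact Finset.prod_congr rfl fun j hj => (if_neg (Finset.ne_of_mem_erase hj)).symm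

/-- The state after a throw showing `j`: one token, if there is one, is removed from bin `j`. -/
def removeToken (ζ : Fin k → ℕ) (j : Fin k) : Fin k → ℕ :=
  fun i => if j = i then ζ i - 1 else ζ i

/-- First-step analysis of the race: the integrand of `lastBinProb` solves the Kolmogorov equation
of the Poissonised throws, and integrating it over time gives the recursion for the embedded
sequence of throws. The hypothesis makes the boundary term at `t = 0` vanish. -/
lemma sum_prob_mul_lastBinProb (d : Die k) (ζ : Fin k → ℕ) (i : Fin k)
    (h : ζ i ≠ 1 ∨ ∃ j, j ≠ i ∧ ζ j ≠ 0) :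
    ∑ j, d.prob j * lastBinProb d (removeToken ζ j) i = lastBinProb d ζ i := by
  set u : Fin k → ℕ → ℝ → ℝ := fun j m t =>
    if j = i then erlangPDF (d.prob j) m t else erlangCDF (d.prob j) m t with hu
  have hderiv : ∀ j m t, HasDerivAt (u j m) (d.prob j * (u j (m - 1) t - u j m t)) t := by
    intro j m t
    by_cases hj : j = i
    · simpa [hu, hj] using hasDerivAt_erlangPDF (d.prob i) m t
    · simpa [hu, hj, ← erlangPDF_eq] using hasDerivAt_erlangCDF (d.prob j) m t
  have hΨ : ∀ t, HasDerivAt (fun t => ∏ j, u j (ζ j) t)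
      (∑ j, d.prob j * (∏ l, u l (removeToken ζ j l) t - ∏ l, u l (ζ l) t)) t := by
    intro t
    refine (HasDerivAt.fun_finsetProd fun j _ => hderiv j (ζ j) t).congr_deriv ?_
    refine Finset.sum_congr rfl fun j _ => ?_
    rw [← Finset.mul_prod_erase _ (fun l => u l (removeToken ζ j l) t) (Finset.mem_univ j),
      ← Finset.mul_prod_erase _ (fun l => u l (ζ l) t) (Finset.mem_univ j)]
    have : ∏ l ∈ Finset.univ.erase j, u l (removeToken ζ j l) t
        = ∏ l ∈ Finset.univ.erase j, u l (ζ l) t :=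
      Finset.prod_congr rfl fun l hl => by
        rw [removeToken, if_neg (Finset.ne_of_mem_erase hl).symm]
    rw [this]
    simp only [removeToken, if_true, smul_eq_mul]
    ring
  have hint : ∀ ξ : Fin k → ℕ, IntegrableOn (fun t => ∏ j, u j (ξ j) t) (Set.Ioi 0) :=
    fun ξ => integrableOn_lastBin d ξ i
  have hlim : Tendsto (fun t => ∏ j, u j (ζ j) t) atTop (𝓝 0) := by
    have h1 : ∀ j, Tendsto (u j (ζ j)) atTop (𝓝 (if j = i then 0 else 1)) := by
      intro j
      by_cases hj : j = i
      · simpa [hu, hj] using tendsto_erlangPDF (d.prob_pos i) (ζ i)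
      · simpa [hu, hj] using tendsto_erlangCDF (d.prob_pos j) (ζ j)
    have h2 := tendsto_finsetProd Finset.univ fun j _ => h1 j
    rwa [Finset.prod_eq_zero (Finset.mem_univ i) (by simp)] at h2
  have h0 : ∏ j, u j (ζ j) 0 = 0 := by
    rcases h with h | ⟨j, hj, hj0⟩
    · exact Finset.prod_eq_zero (Finset.mem_univ i) (by simp [hu, erlangPDF_at_zero _ h])
    · exact Finset.prod_eq_zero (Finset.mem_univ j) (by simp [hu, hj, erlangCDF_at_zero _ hj0])
  have hd : ∀ j, IntegrableOn (fun t => d.prob j *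
      (∏ l, u l (removeToken ζ j l) t - ∏ l, u l (ζ l) t)) (Set.Ioi 0) := fun j =>
    ((hint (removeToken ζ j)).sub (hint ζ)).const_mul _
  have key := integral_Ioi_of_hasDerivAt_of_tendsto (a := 0) (hΨ 0).continuousAt.continuousWithinAt
    (fun t _ => hΨ t) (integrable_finsetSum _ fun j _ => hd j) hlim
  rw [h0, sub_zero, integral_finsetSum _ fun j _ => hd j] at key
  have key2 : ∑ j, (d.prob j * lastBinProb d (removeToken ζ j) i
      - d.prob j * lastBinProb d ζ i) = 0 := by
    rw [← key]
    refine Finset.sum_congr rfl fun j _ => ?_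
    rw [integral_const_mul, integral_sub (hint _) (hint _), ← mul_sub]
    rfl
  rw [Finset.sum_sub_distrib, ← Finset.sum_mul, d.sum_prob, one_mul] at key2
  linarith

/-- Some bin is cleared last. -/
lemma sum_lastBinProb (d : Die k) {ζ : Fin k → ℕ} (h : ζ ≠ 0) : ∑ i, lastBinProb d ζ i = 1 := by
  have hderiv : ∀ t, HasDerivAt (fun t => ∏ j, erlangCDF (d.prob j) (ζ j) t)
      (∑ i, erlangPDF (d.prob i) (ζ i) t *
        ∏ j ∈ Finset.univ.erase i, erlangCDF (d.prob j) (ζ j) t) t := by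
    intro t
    refine (HasDerivAt.fun_finsetProd fun j _ =>
      hasDerivAt_erlangCDF (d.prob j) (ζ j) t).congr_deriv ?_
    exact Finset.sum_congr rfl fun j _ => by rw [smul_eq_mul, mul_comm]
  have hlim : Tendsto (fun t => ∏ j, erlangCDF (d.prob j) (ζ j) t) atTop (𝓝 1) := by
    simpa using tendsto_finsetProd Finset.univ fun j _ =>
      tendsto_erlangCDF (d.prob_pos j) (ζ j)
  have h0 : ∏ j, erlangCDF (d.prob j) (ζ j) 0 = 0 := by
    obtain ⟨j, hj⟩ := Function.ne_iff.1 h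
    exact Finset.prod_eq_zero (Finset.mem_univ j) (erlangCDF_at_zero _ hj)
  have hint : ∀ i, IntegrableOn (fun t => erlangPDF (d.prob i) (ζ i) t *
      ∏ j ∈ Finset.univ.erase i, erlangCDF (d.prob j) (ζ j) t) (Set.Ioi 0) := by
    intro i
    refine (integrableOn_lastBin d ζ i).congr_fun (fun t _ => ?_) measurableSet_Ioi
    beta_reduce
    rw [← Finset.mul_prod_erase _ _ (Finset.mem_univ i), if_pos rfl]
    congr 1
    exact Finset.prod_congr rfl fun j hj => if_neg (Finset.ne_of_mem_erase hj)
  have key := integral_Ioi_of_hasDerivAt_of_tendsto (a := 0)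
    (hderiv 0).continuousAt.continuousWithinAt (fun t _ => hderiv t)
    (integrable_finsetSum _ fun i _ => hint i) hlim
  rw [h0, sub_zero, integral_finsetSum _ fun i _ => hint i] at key
  rw [← key]
  exact Finset.sum_congr rfl fun i _ => lastBinProb_eq d ζ i

/-! ### First-step analysis of the token game -/

lemma tokensLeft_succ_eq (ξ : Fin k → ℕ) (ω : ℕ → Fin k) (t : ℕ) (i : Fin k) :
    tokensLeft ξ ω (t + 1) i = tokensLeft (removeToken ξ (ω 0)) (fun s => ω (s + 1)) t i := by
  induction t with
  | zero => rfl
  | succ t ih => rw [tokensLeft, ih, tokensLeft]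

lemma tokensLeft_antitone (ξ : Fin k → ℕ) (ω : ℕ → Fin k) (i : Fin k) :
    Antitone fun t => tokensLeft ξ ω t i := by
  refine antitone_nat_of_succ_le fun t => ?_
  rw [tokensLeft]
  split_ifs <;> omega

lemma tokensLeft_zero_allocation (ω : ℕ → Fin k) (t : ℕ) (i : Fin k) :
    tokensLeft 0 ω t i = 0 :=
  Nat.eq_zero_of_le_zero (tokensLeft_antitone 0 ω i (Nat.zero_le t))

/-- The event that `ξ` is cleared strictly before `η`. -/
def clearedFirst (ξ η : Fin k → ℕ) : Set (ℕ → Fin k) :=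
  {ω | ∃ t, (∀ i, tokensLeft ξ ω t i = 0) ∧ ¬ ∀ i, tokensLeft η ω t i = 0}

lemma setOf_tokenClearanceTime_lt (ξ η : Fin k → ℕ) :
    {ω | tokenClearanceTime ξ ω < tokenClearanceTime η ω} = clearedFirst ξ η := by
  ext ω
  have hle : ∀ (ζ : Fin k → ℕ) (t : ℕ),
      tokenClearanceTime ζ ω ≤ t ↔ ∀ i, tokensLeft ζ ω t i = 0 := by
    intro ζ t
    constructor
    · intro h i
      have h1 : tokenClearanceTime ζ ω < ((t + 1 : ℕ) : ℕ∞) :=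
        h.trans_lt (by exact_mod_cast Nat.lt_succ_self t)
      simp only [tokenClearanceTime, iInf_lt_iff] at h1
      obtain ⟨s, hs, hst⟩ := h1
      have hst' : s ≤ t := Nat.lt_succ_iff.1 (by exact_mod_cast hst)
      exact Nat.eq_zero_of_le_zero ((tokensLeft_antitone ζ ω i hst').trans_eq (hs i))
    · intro h
      exact iInf₂_le t h
  constructor
  · intro h
    obtain ⟨t, ht⟩ := ENat.ne_top_iff_exists.1 (ne_top_of_lt h)
    refine ⟨t, (hle ξ t).1 ht.symm.le, fun h2 => ?_⟩
    exact absurd ((hle η t).2 h2) (not_le.2 (ht ▸ h))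
  · rintro ⟨t, h1, h2⟩
    exact ((hle ξ t).2 h1).trans_lt (not_le.1 fun h => h2 ((hle η t).1 h))

lemma measurableSet_clearedFirst (ξ η : Fin k → ℕ) : MeasurableSet (clearedFirst ξ η) := by
  have hm : ∀ (ζ : Fin k → ℕ) (t : ℕ) (i : Fin k),
      Measurable fun ω : ℕ → Fin k => tokensLeft ζ ω t i := by
    intro ζ t i
    induction t with
    | zero => exact measurable_const
    | succ t ih =>
      simp only [tokensLeft]
      exact Measurable.ite
        ((measurable_pi_apply t : Measurable fun ω : ℕ → Fin k => ω t) (measurableSet_singleton i))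
        ((measurable_of_countable fun m : ℕ => m - 1).comp ih) ih
  have hc : ∀ (ζ : Fin k → ℕ) (t : ℕ), MeasurableSet {ω | ∀ i, tokensLeft ζ ω t i = 0} := by
    intro ζ t
    rw [Set.ofPred_forall]
    exact MeasurableSet.iInter fun i => hm ζ t i (measurableSet_singleton 0)
  rw [clearedFirst, Set.ofPred_exists]
  exact MeasurableSet.iUnion fun t => (hc ξ t).inter (hc η t).compl

instance Die.isProbabilityMeasure_throws (d : Die k) : IsProbabilityMeasure d.throws := by
  unfold Die.throws
  infer_instance

/-- The sequence of throws with a given first throw and given later throws. -/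
def consThrow (x : Fin k × (ℕ → Fin k)) : ℕ → Fin k
  | 0 => x.1
  | t + 1 => x.2 t

lemma measurable_consThrow : Measurable (consThrow (k := k)) := by
  refine measurable_pi_lambda _ fun t => ?_
  cases t with
  | zero => exact measurable_fst
  | succ t => exact (measurable_pi_apply t).comp measurable_snd

/-- The throws after the first one have the law of the whole sequence and are independent of it. -/
lemma map_cons_throws (d : Die k) :
    (d.law.prod d.throws).map consThrow = d.throws := by
  refine Measure.eq_infinitePi (fun _ : ℕ => d.law) fun s A hA => ?_
  classical
  -- The box may be taken over an initial segment of times.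
  set B : ℕ → Set (Fin k) := fun t => if t ∈ s then A t else Set.univ with hB
  obtain ⟨N, hN⟩ : ∃ N, s ⊆ Finset.range (N + 1) := by
    refine ⟨s.sup id, fun t ht => ?_⟩
    exact Finset.mem_range.2 (Nat.lt_succ_of_le (Finset.le_sup (f := id) ht))
  have hBm : ∀ t, MeasurableSet (B t) := fun t => by
    by_cases ht : t ∈ s
    · simp [hB, ht]
    · simp [hB, ht]
  have hbox : (↑s : Set ℕ).pi A = (↑(Finset.range (N + 1)) : Set ℕ).pi B := by
    ext ω
    simp only [Set.mem_pi, Finset.mem_coe]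
    constructor
    · intro h t _
      by_cases ht : t ∈ s
      · simpa [hB, ht] using h t ht
      · simp [hB, ht]
    · intro h t ht
      simpa [hB, ht] using h t (hN ht)
  have hprod : ∏ t ∈ s, d.law (A t) = ∏ t ∈ Finset.range (N + 1), d.law (B t) := by
    rw [← Finset.prod_subset hN]
    · exact Finset.prod_congr rfl fun t ht => by simp [hB, ht]
    · intro t _ ht
      simp [hB, ht]
  rw [hprod, hbox, Measure.map_apply measurable_consThrow
    (MeasurableSet.pi (Finset.countable_toSet _) fun t _ => hBm t)]
  have hpre : consThrow ⁻¹'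
      ((↑(Finset.range (N + 1)) : Set ℕ).pi B)
      = B 0 ×ˢ (↑(Finset.range N) : Set ℕ).pi fun t => B (t + 1) := by
    ext ⟨a, ω⟩
    simp only [Set.mem_preimage, Set.mem_pi, Finset.mem_coe, Finset.mem_range, Set.mem_prod]
    constructor
    · intro h
      exact ⟨h 0 (Nat.succ_pos N), fun t ht => h (t + 1) (Nat.succ_lt_succ ht)⟩
    · rintro ⟨h0, h1⟩ t ht
      cases t with
      | zero => exact h0
      | succ t => exact h1 t (Nat.lt_of_succ_lt_succ ht)
  rw [hpre, Measure.prod_prod, Die.throws, Measure.infinitePi_pi _ fun t _ => hBm (t + 1),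
    Finset.prod_range_succ', mul_comm]

/-- The recursion holds unless the first player is done, and the second is not, before any throw. -/
lemma measureReal_clearedFirst (d : Die k) (ξ η : Fin k → ℕ) (h : ξ = 0 → η = 0) :
    d.throws.real (clearedFirst ξ η) =
      ∑ j, d.prob j * d.throws.real (clearedFirst (removeToken ξ j) (removeToken η j)) := by
  have hm := measurableSet_clearedFirst ξ η
  have key : d.throws (clearedFirst ξ η) = ∑ j, ENNReal.ofReal (d.prob j) *
      d.throws (clearedFirst (removeToken ξ j) (removeToken η j)) := by
    conv_lhs => rw [← map_cons_throws d]
    rw [Measure.map_apply measurable_consThrow hm,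
      Measure.prod_apply (measurable_consThrow hm), Die.law, lintegral_finsetSum_measure]
    refine Finset.sum_congr rfl fun j _ => ?_
    rw [lintegral_smul_measure, lintegral_dirac, smul_eq_mul]
    congr 2
    ext ω
    simp only [Set.mem_preimage, clearedFirst, Set.mem_ofPred_eq]
    have hcons : ∀ (ζ : Fin k → ℕ) (t : ℕ) (i : Fin k),
        tokensLeft ζ (consThrow (j, ω)) (t + 1) i = tokensLeft (removeToken ζ j) ω t i :=
      fun ζ t i => tokensLeft_succ_eq ζ _ t i
    constructor
    · rintro ⟨t, h1, h2⟩
      cases t with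
      | zero =>
        have hξ : ξ = 0 := funext h1
        exact absurd (fun i => congrFun (h hξ) i) h2
      | succ t =>
        simp only [hcons] at h1 h2
        exact ⟨t, h1, h2⟩
    · rintro ⟨t, h1, h2⟩
      refine ⟨t + 1, ?_, ?_⟩
      · simpa only [hcons] using h1
      · simpa only [hcons] using h2
  rw [Measure.real, key, ENNReal.toReal_sum fun j _ =>
    ENNReal.mul_ne_top ENNReal.ofReal_ne_top (measure_ne_top _ _)]
  refine Finset.sum_congr rfl fun j _ => ?_
  rw [ENNReal.toReal_mul, ENNReal.toReal_ofReal (d.prob_pos j).le, Measure.real]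

lemma removeToken_sup (ξ η : Fin k → ℕ) (j : Fin k) :
    removeToken ξ j ⊔ removeToken η j = removeToken (ξ ⊔ η) j := by
  ext i
  simp only [removeToken, Pi.sup_apply]
  split_ifs <;> omega

/-- The first player clears first exactly if the last token of the coordinatewise maximum of the two
allocations lies in a bin in which the second player has more tokens. Both sides obey the same
recursion in the total number of tokens, which yields the identity for the throws of the die and
the Poissonised race at once. -/
theorem measureReal_clearedFirst_eq (d : Die k) (ξ η : Fin k → ℕ) :
    d.throws.real (clearedFirst ξ η) =
      ∑ i, if ξ i < η i then lastBinProb d (ξ ⊔ η) i else 0 := by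
  induction hN : ∑ i, (ξ i + η i) using Nat.strong_induction_on generalizing ξ η with
  | _ N ih =>
  subst hN
  by_cases hη : η = 0
  · subst hη
    have : clearedFirst ξ (0 : Fin k → ℕ) = ∅ := by
      ext ω
      simp [clearedFirst, tokensLeft_zero_allocation]
    simp [this]
  by_cases hξ : ξ = 0
  · subst hξ
    have : clearedFirst (0 : Fin k → ℕ) η = Set.univ := by
      refine Set.eq_univ_of_forall fun ω => ⟨0, fun i => rfl, fun h => hη (funext h)⟩
    rw [this, probReal_univ]
    have hsup : (0 : Fin k → ℕ) ⊔ η = η := by ext i; simp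
    rw [hsup, ← sum_lastBinProb d hη]
    refine Finset.sum_congr rfl fun i _ => ?_
    split_ifs with hi
    · rfl
    · exact lastBinProb_of_eq_zero d (by simpa using hi)
  set P : (Fin k → ℕ) → (Fin k → ℕ) → ℝ := fun ξ η => d.throws.real (clearedFirst ξ η) with hP
  set S : (Fin k → ℕ) → (Fin k → ℕ) → ℝ := fun ξ η =>
    ∑ i, if ξ i < η i then lastBinProb d (ξ ⊔ η) i else 0 with hS
  have hPrec : P ξ η = ∑ j, d.prob j * P (removeToken ξ j) (removeToken η j) :=
    measureReal_clearedFirst d ξ η fun h => absurd h hξ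
  have hSrec : S ξ η = ∑ j, d.prob j * S (removeToken ξ j) (removeToken η j) := by
    simp only [hS, Finset.mul_sum, removeToken_sup]
    rw [Finset.sum_comm]
    refine Finset.sum_congr rfl fun i _ => ?_
    have hstep : ∀ j, (if removeToken ξ j i < removeToken η j i
        then lastBinProb d (removeToken (ξ ⊔ η) j) i else 0)
        = if ξ i < η i then lastBinProb d (removeToken (ξ ⊔ η) j) i else 0 := by
      intro j
      -- The comparison is lost only when the bin becomes empty for both players.
      by_cases hz : removeToken (ξ ⊔ η) j i = 0
      · simp [lastBinProb_of_eq_zero d hz]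
      · have : removeToken ξ j i < removeToken η j i ↔ ξ i < η i := by
          simp only [removeToken, Pi.sup_apply] at hz ⊢
          split_ifs at hz ⊢ <;> omega
        simp only [this]
    simp only [hstep]
    split_ifs with hi
    · refine (sum_prob_mul_lastBinProb d (ξ ⊔ η) i ?_).symm
      obtain ⟨j, hj⟩ := Function.ne_iff.1 hξ
      simp only [Pi.zero_apply] at hj
      by_cases hji : j = i
      · subst hji
        left
        simp only [Pi.sup_apply]
        omega
      · right
        refine ⟨j, hji, ?_⟩
        simp only [Pi.sup_apply]
        omega
    · simp
  have hdiff : ∀ j, (ξ ⊔ η) j ≠ 0 →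
      P (removeToken ξ j) (removeToken η j) = S (removeToken ξ j) (removeToken η j) := by
    intro j hj
    refine ih _ ?_ _ _ rfl
    refine Finset.sum_lt_sum (fun i _ => ?_) ⟨j, Finset.mem_univ j, ?_⟩
    · simp only [removeToken]
      split_ifs <;> omega
    · simp only [Pi.sup_apply] at hj
      simp only [removeToken, if_true]
      omega
  have hsame : ∀ j, (ξ ⊔ η) j = 0 → removeToken ξ j = ξ ∧ removeToken η j = η := by
    intro j hj
    simp only [Pi.sup_apply] at hj
    constructor <;> ext i <;> simp only [removeToken] <;> split_ifs with h
    all_goals first | rfl | (subst h; omega)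
  have h0 : (P ξ η - S ξ η) * ∑ j, (if (ξ ⊔ η) j = 0 then 0 else d.prob j) = 0 := by
    have h1 : P ξ η - S ξ η = (P ξ η - S ξ η) * ∑ j, (if (ξ ⊔ η) j = 0 then d.prob j else 0) := by
      conv_lhs => rw [hPrec, hSrec, ← Finset.sum_sub_distrib]
      rw [Finset.mul_sum]
      refine Finset.sum_congr rfl fun j _ => ?_
      split_ifs with hj
      · rw [(hsame j hj).1, (hsame j hj).2]
        ring
      · rw [hdiff j hj]
        ring
    have h2 : ∑ j, (if (ξ ⊔ η) j = 0 then 0 else d.prob j)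
        = 1 - ∑ j, (if (ξ ⊔ η) j = 0 then d.prob j else 0) := by
      rw [← d.sum_prob, ← Finset.sum_sub_distrib]
      exact Finset.sum_congr rfl fun j _ => by split_ifs <;> simp
    rw [h2]
    linarith
  have hpos : 0 < ∑ j, (if (ξ ⊔ η) j = 0 then 0 else d.prob j) := by
    obtain ⟨j, hj⟩ := Function.ne_iff.1 hξ
    simp only [Pi.zero_apply] at hj
    have hj' : (ξ ⊔ η) j ≠ 0 := by
      simp only [Pi.sup_apply]
      omega
    refine Finset.sum_pos' (fun i _ => ?_) ⟨j, Finset.mem_univ j, ?_⟩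
    · split_ifs
      exacts [le_rfl, (d.prob_pos i).le]
    · rw [if_neg hj']
      exact d.prob_pos j
  have := (mul_eq_zero.1 h0).resolve_right hpos.ne'
  exact sub_eq_zero.1 this

lemma tokenPayoff_eq {n : ℕ} (d : Die k) (ξ η : Allocation k n) :
    tokenPayoff d ξ η =
      (∑ i, SignType.sign ((η.1 i : ℝ) - ξ.1 i) * lastBinProb d (ξ.1 ⊔ η.1) i) / 2 := by
  rw [tokenPayoff, setOf_tokenClearanceTime_lt, setOf_tokenClearanceTime_lt,
    measureReal_clearedFirst_eq, measureReal_clearedFirst_eq, sup_comm η.1, ←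
    Finset.sum_sub_distrib]
  congr 1
  refine Finset.sum_congr rfl fun i _ => ?_
  rcases lt_trichotomy (ξ.1 i) (η.1 i) with h | h | h
  · have : (0 : ℝ) < (η.1 i : ℝ) - ξ.1 i := sub_pos.2 (by exact_mod_cast h)
    simp [h, h.not_gt, sign_pos this]
  · simp [h]
  · have : (η.1 i : ℝ) - ξ.1 i < 0 := sub_neg.2 (by exact_mod_cast h)
    simp [h, h.not_gt, sign_neg this]

lemma tokenPayoff_swap {n : ℕ} (d : Die k) (ξ η : Allocation k n) :
    tokenPayoff d η ξ = -tokenPayoff d ξ η := by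
  rw [tokenPayoff, tokenPayoff]
  ring

lemma abs_tokenPayoff_le {n : ℕ} (d : Die k) (ξ η : Allocation k n) :
    |tokenPayoff d ξ η| ≤ 1 := by
  have h : ∀ s : Set (ℕ → Fin k), 0 ≤ d.throws.real s ∧ d.throws.real s ≤ 1 :=
    fun s => ⟨measureReal_nonneg, measureReal_le_one⟩
  rw [tokenPayoff, abs_le]
  have h1 := h {ω | tokenClearanceTime ξ.1 ω < tokenClearanceTime η.1 ω}
  have h2 := h {ω | tokenClearanceTime η.1 ω < tokenClearanceTime ξ.1 ω}
  constructor <;> linarith [h1.1, h1.2, h2.1, h2.2]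

/-! ### Convergence of densities -/

/-- If probability densities converge pointwise, then the integrals against them of `[0, 1]`-valued
functions that converge pointwise converge too (Scheffé's lemma and dominated convergence). -/
lemma tendsto_integral_density_mul {Ω ι : Type*} [MeasurableSpace Ω] {μ : Measure Ω} {l : Filter ι}
    [l.IsCountablyGenerated] {g : ι → Ω → ℝ} {g₀ : Ω → ℝ} {P : ι → Ω → ℝ} {P₀ : Ω → ℝ}
    (hg0 : ∀ᶠ a in l, ∀ x, 0 ≤ g a x) (hgi : ∀ᶠ a in l, Integrable (g a) μ)
    (hg1 : ∀ᶠ a in l, ∫ x, g a x ∂μ = 1)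
    (hg₀0 : ∀ x, 0 ≤ g₀ x) (hg₀i : Integrable g₀ μ) (hg₀1 : ∫ x, g₀ x ∂μ = 1)
    (hlim : ∀ x, Tendsto (fun a => g a x) l (𝓝 (g₀ x)))
    (hPm : ∀ᶠ a in l, AEStronglyMeasurable (P a) μ) (hP : ∀ᶠ a in l, ∀ x, P a x ∈ Set.Icc (0 : ℝ) 1)
    (hPlim : ∀ x, Tendsto (fun a => P a x) l (𝓝 (P₀ x))) :
    Tendsto (fun a => ∫ x, g a x * P a x ∂μ) l (𝓝 (∫ x, g₀ x * P₀ x ∂μ)) := by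
  have hneg : Tendsto (fun a => ∫ x, max (g₀ x - g a x) 0 ∂μ) l (𝓝 (∫ _x, (0 : ℝ) ∂μ)) := by
    refine tendsto_integral_filter_of_dominated_convergence g₀ ?_ ?_ hg₀i ?_
    · filter_upwards [hgi] with a ha
      exact ((hg₀i.sub ha).sup (integrable_zero Ω ℝ μ)).aestronglyMeasurable
    · filter_upwards [hg0] with a ha
      refine .of_forall fun x => ?_
      rw [Real.norm_eq_abs, abs_of_nonneg (le_max_right _ _)]
      exact max_le (by linarith [ha x]) (hg₀0 x)
    · refine .of_forall fun x => ?_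
      have h : Tendsto (fun a => max (g₀ x - g a x) 0) l (𝓝 (max (g₀ x - g₀ x) 0)) :=
        (tendsto_const_nhds.sub (hlim x)).max tendsto_const_nhds
      simpa using h
  rw [integral_zero] at hneg
  have hL1 : Tendsto (fun a => ∫ x, |g a x - g₀ x| ∂μ) l (𝓝 0) := by
    have h2 : Tendsto (fun a => 2 * ∫ x, max (g₀ x - g a x) 0 ∂μ) l (𝓝 0) := by
      simpa using hneg.const_mul 2
    refine h2.congr' ?_
    filter_upwards [hgi, hg1] with a hai ha1
    have hm : Integrable (fun x => max (g₀ x - g a x) 0) μ :=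
      (hg₀i.sub hai).sup (integrable_zero Ω ℝ μ)
    have h3 : ∀ x, |g a x - g₀ x| = (g a x - g₀ x) + 2 * max (g₀ x - g a x) 0 := by
      intro x
      rcases le_total (g₀ x) (g a x) with h | h
      · rw [abs_of_nonneg (by linarith), max_eq_right (by linarith)]
        ring
      · rw [abs_of_nonpos (by linarith), max_eq_left (by linarith)]
        ring
    simp only [h3]
    have hgs : Integrable (fun x => g a x - g₀ x) μ := hai.sub hg₀i
    rw [integral_add hgs (hm.const_mul 2), integral_sub hai hg₀i, ha1, hg₀1,
      integral_const_mul]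
    ring
  have hmain : Tendsto (fun a => ∫ x, g₀ x * P a x ∂μ) l (𝓝 (∫ x, g₀ x * P₀ x ∂μ)) := by
    refine tendsto_integral_filter_of_dominated_convergence g₀ ?_ ?_ hg₀i ?_
    · filter_upwards [hPm] with a ha
      exact hg₀i.aestronglyMeasurable.mul ha
    · filter_upwards [hP] with a ha
      refine .of_forall fun x => ?_
      rw [Real.norm_eq_abs, abs_of_nonneg (mul_nonneg (hg₀0 x) (ha x).1)]
      exact mul_le_of_le_one_right (hg₀0 x) (ha x).2
    · exact .of_forall fun x => tendsto_const_nhds.mul (hPlim x)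
  have hdiff : Tendsto (fun a => ∫ x, (g a x - g₀ x) * P a x ∂μ) l (𝓝 0) := by
    refine squeeze_zero_norm' ?_ hL1
    filter_upwards [hgi, hPm, hP] with a hai ham haP
    refine norm_integral_le_of_norm_le (hai.sub hg₀i).abs (.of_forall fun x => ?_)
    rw [norm_mul, Real.norm_eq_abs, Real.norm_eq_abs, abs_of_nonneg (haP x).1]
    exact mul_le_of_le_one_right (abs_nonneg _) (haP x).2
  have hsum := hdiff.add hmain
  rw [zero_add] at hsum
  refine hsum.congr' ?_
  filter_upwards [hgi, hPm, hP] with a hai ham haP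
  have hb : ∀ {f : Ω → ℝ}, Integrable f μ → Integrable (fun x => f x * P a x) μ := by
    intro f hf
    refine hf.mul_bdd (c := 1) ham (.of_forall fun x => ?_)
    rw [Real.norm_eq_abs, abs_of_nonneg (haP x).1]
    exact (haP x).2
  have hgs : Integrable (fun x => (g a x - g₀ x) * P a x) μ := hb (hai.sub hg₀i)
  rw [← integral_add hgs (hb hg₀i)]
  refine integral_congr_ae (.of_forall fun x => ?_)
  ring

lemma tendsto_setIntegral_density {Ω ι : Type*} [MeasurableSpace Ω] {μ : Measure Ω} {l : Filter ι}
    [l.IsCountablyGenerated] {g : ι → Ω → ℝ} {g₀ : Ω → ℝ} {A : Set Ω} (hA : MeasurableSet A)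
    (hg0 : ∀ᶠ a in l, ∀ x, 0 ≤ g a x) (hgi : ∀ᶠ a in l, Integrable (g a) μ)
    (hg1 : ∀ᶠ a in l, ∫ x, g a x ∂μ = 1)
    (hg₀0 : ∀ x, 0 ≤ g₀ x) (hg₀i : Integrable g₀ μ) (hg₀1 : ∫ x, g₀ x ∂μ = 1)
    (hlim : ∀ x, Tendsto (fun a => g a x) l (𝓝 (g₀ x))) :
    Tendsto (fun a => ∫ x in A, g a x ∂μ) l (𝓝 (∫ x in A, g₀ x ∂μ)) := by
  have h := tendsto_integral_density_mul (P := fun _ => A.indicator 1) (P₀ := A.indicator 1)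
    hg0 hgi hg1 hg₀0 hg₀i hg₀1 hlim
    (.of_forall fun _ => (aestronglyMeasurable_one).indicator hA)
    (.of_forall fun _ x => ⟨Set.indicator_nonneg (fun _ _ => zero_le_one) x,
      Set.indicator_le_self' (fun _ _ => zero_le_one) x⟩) (fun x => tendsto_const_nhds)
  simpa only [← Set.indicator_mul_right, Pi.one_apply, mul_one, integral_indicator hA] using h

lemma integral_comp_affine (f : ℝ → ℝ) (b : ℝ) {c : ℝ} (hc : 0 < c) :
    ∫ s, c * f (b + s * c) = ∫ t, f t := by
  rw [integral_const_mul, Measure.integral_comp_mul_right (fun t => f (b + t)) c,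
    integral_add_left_eq_self f b, smul_eq_mul, abs_of_pos (inv_pos.2 hc), ← mul_assoc,
    mul_inv_cancel₀ hc.ne', one_mul]

/-! ### The local limit theorem for Erlang densities -/

lemma poissonWeight_eq_stirling {a : ℕ} (ha : a ≠ 0) {u : ℝ} (hu : 0 < u) :
    poissonWeight a u = Real.exp (a * (Real.log (1 + (u - a) / a) - (u - a) / a)) /
      (Stirling.stirlingSeq a * √(2 * a)) := by
  have ha' : (0 : ℝ) < a := by exact_mod_cast Nat.pos_of_ne_zero ha
  have h1 : 1 + (u - a) / a = u / a := by field_simp; ring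
  have h2 : a * (Real.log (u / a) - (u - a) / a) = -u + a + a * Real.log (u / a) := by
    field_simp
    ring
  have h3 : Real.exp (a * Real.log (u / a)) = (u / a) ^ a := by
    rw [Real.exp_nat_mul, Real.exp_log (by positivity)]
  have hs : (0 : ℝ) < √(2 * a) := by positivity
  have he : (Real.exp 1) ^ a = Real.exp a := by rw [← Real.exp_nat_mul, mul_one]
  rw [h1, h2, Real.exp_add, Real.exp_add, h3, poissonWeight, Stirling.stirlingSeq, div_pow, div_pow,
    he]
  have hf : (a.factorial : ℝ) ≠ 0 := by positivity
  have hE : Real.exp (a : ℝ) ≠ 0 := (Real.exp_pos _).ne'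
  field_simp

/-- On the time scale `t = n + s √n`, the density of the clearance time of `m ≈ p n + w √n` tokens
tends to the Gaussian density of mean `w / p` and variance `1 / p`. -/
lemma tendsto_erlangPDF_gaussian {ι : Type*} {l : Filter ι} {p : ℝ} (hp : 0 < p) {N m : ι → ℕ}
    (hN : Tendsto N l atTop) {w : ℝ}
    (hm : Tendsto (fun a => ((m a : ℝ) - p * N a) / √(N a)) l (𝓝 w)) (s : ℝ) :
    Tendsto (fun a => √(N a) * erlangPDF p (m a) (N a + s * √(N a))) l
      (𝓝 (gaussianPDFReal (w / p) (Real.toNNReal p⁻¹) s)) := by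
  have hNr : Tendsto (fun a => (N a : ℝ)) l atTop := tendsto_natCast_atTop_atTop.comp hN
  set r : ι → ℝ := fun a => √(N a) with hr
  have hrt : Tendsto r l atTop := Real.tendsto_sqrt_atTop.comp hNr
  have hri : Tendsto (fun a => (r a)⁻¹) l (𝓝 0) := tendsto_inv_atTop_zero.comp hrt
  have hsq : ∀ a, (N a : ℝ) = r a * r a := fun a =>
    (Real.mul_self_sqrt (Nat.cast_nonneg _)).symm
  have hrpos : ∀ᶠ a in l, 0 < r a := hrt.eventually_gt_atTop 0
  set ω : ι → ℝ := fun a => ((m a : ℝ) - p * N a) / r a with hω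
  -- `q` is `(m - 1) / n`.
  set q : ι → ℝ := fun a => p + ω a * (r a)⁻¹ - (r a)⁻¹ * (r a)⁻¹ with hq
  have hqt : Tendsto q l (𝓝 p) := by
    simpa using (tendsto_const_nhds.add (hm.mul hri)).sub (hri.mul hri)
  set c : ι → ℝ := fun a => p * s - ω a + (r a)⁻¹ with hc
  have hct : Tendsto c l (𝓝 (p * s - w)) := by
    simpa using (tendsto_const_nhds.sub hm).add hri
  set v : ι → ℝ := fun a => c a / q a * (r a)⁻¹ with hv
  have hvt : Tendsto v l (𝓝 0) := by
    simpa using (hct.div hqt hp.ne').mul hri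
  have hmr : ∀ᶠ a in l, (m a : ℝ) = q a * (r a * r a) + 1 := by
    filter_upwards [hrpos] with a ha
    simp only [hq, hω, hsq]
    field_simp
    ring
  have hqpos : ∀ᶠ a in l, 0 < q a := hqt.eventually_const_lt hp
  have hm2 : ∀ᶠ a in l, ∃ b : ℕ, b ≠ 0 ∧ m a = b + 1 ∧ (b : ℝ) = q a * (r a * r a) := by
    filter_upwards [hmr, hrpos, hqpos] with a ha har haq
    have h0 : 0 < q a * (r a * r a) := by positivity
    have h1 : 1 < m a := by
      have : (1 : ℝ) < m a := by linarith
      exact_mod_cast this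
    refine ⟨m a - 1, by omega, by omega, ?_⟩
    rw [Nat.cast_sub h1.le]
    push_cast
    linarith
  have hb : Tendsto (fun a => m a - 1) l atTop := by
    refine tendsto_natCast_atTop_iff (R := ℝ) |>.1 ?_
    have h1 : Tendsto (fun a => q a * (r a * r a)) l atTop :=
      hqt.pos_mul_atTop hp (hrt.atTop_mul_atTop₀ hrt)
    refine h1.congr' ?_
    filter_upwards [hm2] with a ⟨b, _, hb1, hb2⟩
    rw [hb1, Nat.add_sub_cancel, hb2]
  have hst := Stirling.tendsto_stirlingSeq_sqrt_pi.comp hb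
  -- The exponent in Stirling's form is `q r² (log (1 + v) - v)`, and `q r² v² = c² / q`.
  have hexp : Tendsto (fun a => q a * (r a * r a) * (Real.log (1 + v a) - v a)) l
      (𝓝 (-((p * s - w) ^ 2 / p / 2))) := by
    have h1 : Tendsto (fun a => c a ^ 2 / q a) l (𝓝 ((p * s - w) ^ 2 / p)) :=
      (hct.pow 2).div hqt hp.ne'
    have h2 : Tendsto (fun a => c a ^ 2 / q a * (|v a| / (1 - |v a|))) l (𝓝 0) := by
      have hva : Tendsto (fun a => |v a|) l (𝓝 0) := by simpa using hvt.abs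
      have h3 : Tendsto (fun a => |v a| / (1 - |v a|)) l (𝓝 (0 / (1 - 0))) :=
        hva.div (tendsto_const_nhds.sub hva) (by norm_num)
      simpa using h1.mul h3
    have h4 : Tendsto (fun a => q a * (r a * r a) * (Real.log (1 + v a) - v a) +
        c a ^ 2 / q a / 2) l (𝓝 0) := by
      refine squeeze_zero_norm' ?_ h2
      have hva1 : ∀ᶠ a in l, |v a| < 1 := by
        have hva : Tendsto (fun a => |v a|) l (𝓝 0) := by simpa using hvt.abs
        exact hva.eventually_lt_const one_pos
      filter_upwards [hrpos, hqpos, hva1] with a har haq hav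
      have h5 := Real.abs_log_sub_add_sum_range_le (x := -v a) (by rwa [abs_neg]) 2
      have hcv : c a ^ 2 / q a = q a * (r a * r a) * |v a| ^ 2 := by
        rw [sq_abs]
        simp only [hv]
        field_simp
      have h6 : q a * (r a * r a) * (Real.log (1 + v a) - v a) + c a ^ 2 / q a / 2
          = q a * (r a * r a) *
            (∑ i ∈ Finset.range 2, (-v a) ^ (i + 1) / ((i : ℝ) + 1) + Real.log (1 - -v a)) := by
        rw [hcv, sq_abs, Finset.sum_range_succ, Finset.sum_range_one]
        push_cast
        rw [sub_neg_eq_add]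
        ring
      rw [h6, Real.norm_eq_abs, abs_mul, abs_of_pos (by positivity : 0 < q a * (r a * r a)), hcv]
      calc _ ≤ q a * (r a * r a) * (|-v a| ^ (2 + 1) / (1 - |-v a|)) := by gcongr
        _ = _ := by rw [abs_neg]; ring
    have h7 := h4.sub (h1.div_const 2)
    simpa using h7
  have hlim : Tendsto (fun a => p * (Real.exp (q a * (r a * r a) * (Real.log (1 + v a) - v a)) /
      (Stirling.stirlingSeq (m a - 1) * √(2 * q a)))) l
      (𝓝 (p * (Real.exp (-((p * s - w) ^ 2 / p / 2)) / (√Real.pi * √(2 * p))))) := by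
    refine ((Real.continuous_exp.tendsto _).comp hexp |>.div
      (hst.mul ((Real.continuous_sqrt.tendsto _).comp (hqt.const_mul 2))) ?_).const_mul p
    have := Real.pi_pos
    positivity
  have hval : p * (Real.exp (-((p * s - w) ^ 2 / p / 2)) / (√Real.pi * √(2 * p)))
      = gaussianPDFReal (w / p) (Real.toNNReal p⁻¹) s := by
    rw [gaussianPDFReal, Real.coe_toNNReal _ (inv_nonneg.2 hp.le)]
    have h1 : -((p * s - w) ^ 2 / p / 2) = -(s - w / p) ^ 2 / (2 * p⁻¹) := by
      field_simp
    have h2 : p = √p * √p := (Real.mul_self_sqrt hp.le).symm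
    have h3 : √(2 * Real.pi * p⁻¹) = √Real.pi * √(2 * p) / p := by
      have h4 : √Real.pi * √(2 * p) = √(2 * Real.pi * p⁻¹) * p := by
        rw [← Real.sqrt_mul Real.pi_pos.le]
        conv_rhs => rw [← Real.sqrt_sq hp.le, ← Real.sqrt_mul (by positivity)]
        congr 1
        rw [Real.sqrt_sq hp.le]
        field_simp
      rw [h4]
      field_simp
    rw [h1, h3]
    have := Real.pi_pos
    field_simp
  rw [← hval]
  refine hlim.congr' ?_
  have hupos : ∀ᶠ a in l, 0 < r a + s := by
    filter_upwards [hrt.eventually_gt_atTop (-s)] with a ha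
    linarith
  filter_upwards [hm2, hrpos, hqpos, hupos] with a ⟨b, hb0, hb1, hb2⟩ har haq hau
  have hu : 0 < p * ((N a : ℝ) + s * r a) := by
    rw [hsq]
    have : 0 < r a * (r a + s) := by positivity
    nlinarith
  have hdiv : (p * ((N a : ℝ) + s * r a) - b) / b = v a := by
    have hwa : ω a * r a = m a - p * (r a * r a) := by
      simp only [hω, hsq]
      field_simp
    have hmb : (m a : ℝ) = b + 1 := by rw [hb1]; push_cast; ring
    have hca : c a * r a = p * s * r a + p * (r a * r a) - b := by
      simp only [hc]
      have : (r a)⁻¹ * r a = 1 := inv_mul_cancel₀ har.ne'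
      rw [hmb] at hwa
      linear_combination -hwa + this
    rw [hsq]
    simp only [hv]
    have e1 : p * (r a * r a + s * r a) - b = c a * r a := by rw [hca]; ring
    rw [e1, hb2]
    field_simp
  have hsqrt : √(2 * (b : ℝ)) = √(2 * q a) * r a := by
    rw [hb2, ← mul_assoc, Real.sqrt_mul (by positivity), Real.sqrt_mul_self har.le]
  rw [hb1, Nat.add_sub_cancel, erlangPDF, poissonWeight_eq_stirling hb0 hu, hdiv, hsqrt, hb2]
  have hS : Stirling.stirlingSeq b ≠ 0 := by
    obtain ⟨b', rfl⟩ := Nat.exists_eq_succ_of_ne_zero hb0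
    exact (Stirling.stirlingSeq'_pos b').ne'
  have : √(2 * q a) ≠ 0 := by positivity
  field_simp
  rfl

/-! ### The Gaussian race and its approximation -/

/-- The density of `w j / p j + Z / √(p j)` for a standard normal `Z`. -/
noncomputable def clearancePDF (d : Die k) (w : Fin k → ℝ) (j : Fin k) (s : ℝ) : ℝ :=
  gaussianPDFReal (w j / d.prob j) (Real.toNNReal (d.prob j)⁻¹) s

/-- The distribution function of `w j / p j + Z / √(p j)` for a standard normal `Z`. -/
noncomputable def clearanceCDF (d : Die k) (w : Fin k → ℝ) (j : Fin k) (s : ℝ) : ℝ :=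
  ∫ u in Set.Iic s, clearancePDF d w j u

/-- The probability that `w j / p j + Z j / √(p j)` is largest for `j = i`, where the `Z j` are
independent standard normal variables. -/
noncomputable def argmaxProb (d : Die k) (w : Fin k → ℝ) (i : Fin k) : ℝ :=
  ∫ s, clearancePDF d w i s * ∏ j ∈ Finset.univ.erase i, clearanceCDF d w j s

/-- The Erlang density on the time scale `t = N + s √N`, extended by `0` to negative times. -/
noncomputable def scaledErlangPDF (p : ℝ) (N m : ℕ) (s : ℝ) : ℝ :=
  if 0 < N + s * √N then √N * erlangPDF p m (N + s * √N) else 0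

/-- The Erlang distribution function on the time scale `t = N + s √N`, extended by `0` to negative
times. -/
noncomputable def scaledErlangCDF (p : ℝ) (N m : ℕ) (s : ℝ) : ℝ :=
  if 0 < N + s * √N then erlangCDF p m (N + s * √N) else 0

lemma toNNReal_inv_prob_ne_zero (d : Die k) (j : Fin k) : Real.toNNReal (d.prob j)⁻¹ ≠ 0 :=
  (Real.toNNReal_pos.2 (inv_pos.2 (d.prob_pos j))).ne'

lemma clearancePDF_pos (d : Die k) (w : Fin k → ℝ) (j : Fin k) (s : ℝ) :
    0 < clearancePDF d w j s :=
  gaussianPDFReal_pos _ _ _ (toNNReal_inv_prob_ne_zero d j)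

lemma integrable_clearancePDF (d : Die k) (w : Fin k → ℝ) (j : Fin k) :
    Integrable (clearancePDF d w j) :=
  integrable_gaussianPDFReal _ _

lemma integral_clearancePDF (d : Die k) (w : Fin k → ℝ) (j : Fin k) :
    ∫ s, clearancePDF d w j s = 1 :=
  integral_gaussianPDFReal_eq_one _ (toNNReal_inv_prob_ne_zero d j)

lemma clearanceCDF_pos (d : Die k) (w : Fin k → ℝ) (j : Fin k) (s : ℝ) :
    0 < clearanceCDF d w j s := by
  refine (setIntegral_pos_iff_support_of_nonneg_ae
    (.of_forall fun u => (clearancePDF_pos d w j u).le)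
    (integrable_clearancePDF d w j).integrableOn).2 ?_
  have : Function.support (fun u => clearancePDF d w j u) = Set.univ :=
    Set.eq_univ_of_forall fun u => (clearancePDF_pos d w j u).ne'
  rw [this, Set.univ_inter, Real.volume_Iic]
  exact ENNReal.zero_lt_top

lemma clearanceCDF_le_one (d : Die k) (w : Fin k → ℝ) (j : Fin k) (s : ℝ) :
    clearanceCDF d w j s ≤ 1 := by
  rw [← integral_clearancePDF d w j]
  exact setIntegral_le_integral (integrable_clearancePDF d w j)
    (.of_forall fun u => (clearancePDF_pos d w j u).le)

lemma measurable_clearanceCDF (d : Die k) (w : Fin k → ℝ) (j : Fin k) :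
    Measurable (clearanceCDF d w j) := by
  refine Monotone.measurable fun s t hst => ?_
  exact setIntegral_mono_set (integrable_clearancePDF d w j).integrableOn
    (.of_forall fun u => (clearancePDF_pos d w j u).le) (Set.Iic_subset_Iic.2 hst).eventuallyLE

lemma prod_clearanceCDF_mem (d : Die k) (w : Fin k → ℝ) (S : Finset (Fin k)) (s : ℝ) :
    ∏ j ∈ S, clearanceCDF d w j s ∈ Set.Icc (0 : ℝ) 1 :=
  ⟨Finset.prod_nonneg fun j _ => (clearanceCDF_pos d w j s).le,
    Finset.prod_le_one (fun j _ => (clearanceCDF_pos d w j s).le)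
      fun j _ => clearanceCDF_le_one d w j s⟩

lemma measurable_prod_clearanceCDF (d : Die k) (w : Fin k → ℝ) (S : Finset (Fin k)) :
    Measurable fun s => ∏ j ∈ S, clearanceCDF d w j s :=
  Finset.measurable_fun_prod _ fun j _ => measurable_clearanceCDF d w j

lemma integrable_argmaxProb (d : Die k) (w : Fin k → ℝ) (i : Fin k) :
    Integrable fun s => clearancePDF d w i s *
      ∏ j ∈ Finset.univ.erase i, clearanceCDF d w j s := by
  refine (integrable_clearancePDF d w i).mul_bdd (c := 1)
    (measurable_prod_clearanceCDF d w _).aestronglyMeasurable (.of_forall fun s => ?_)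
  rw [Real.norm_eq_abs, abs_of_nonneg (prod_clearanceCDF_mem d w _ s).1]
  exact (prod_clearanceCDF_mem d w _ s).2

lemma argmaxProb_pos (d : Die k) (w : Fin k → ℝ) (i : Fin k) : 0 < argmaxProb d w i := by
  have hpos : ∀ s, 0 < clearancePDF d w i s *
      ∏ j ∈ Finset.univ.erase i, clearanceCDF d w j s := fun s =>
    mul_pos (clearancePDF_pos d w i s) (Finset.prod_pos fun j _ => clearanceCDF_pos d w j s)
  refine (integral_pos_iff_support_of_nonneg (fun s => (hpos s).le)
    (integrable_argmaxProb d w i)).2 ?_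
  have : Function.support (fun s => clearancePDF d w i s *
      ∏ j ∈ Finset.univ.erase i, clearanceCDF d w j s) = Set.univ :=
    Set.eq_univ_of_forall fun s => (hpos s).ne'
  rw [this, Real.volume_univ]
  exact ENNReal.zero_lt_top

lemma argmaxProb_le_one (d : Die k) (w : Fin k → ℝ) (i : Fin k) : argmaxProb d w i ≤ 1 := by
  rw [← integral_clearancePDF d w i]
  refine integral_mono (integrable_argmaxProb d w i) (integrable_clearancePDF d w i) fun s => ?_
  exact mul_le_of_le_one_right (clearancePDF_pos d w i s).le (prod_clearanceCDF_mem d w _ s).2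

lemma continuous_argmaxProb (d : Die k) (i : Fin k) :
    Continuous fun w : Fin k → ℝ => argmaxProb d w i := by
  refine continuous_iff_continuousAt.2 fun w₀ => ?_
  have hpdf : ∀ j s, Tendsto (fun w : Fin k → ℝ => clearancePDF d w j s) (𝓝 w₀)
      (𝓝 (clearancePDF d w₀ j s)) := by
    intro j s
    refine Continuous.tendsto (f := fun w : Fin k → ℝ => clearancePDF d w j s) ?_ w₀
    simp only [clearancePDF, gaussianPDFReal]
    fun_prop
  refine tendsto_integral_density_mul
    (.of_forall fun w s => (clearancePDF_pos d w i s).le)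
    (.of_forall fun w => integrable_clearancePDF d w i)
    (.of_forall fun w => integral_clearancePDF d w i)
    (fun s => (clearancePDF_pos d w₀ i s).le) (integrable_clearancePDF d w₀ i)
    (integral_clearancePDF d w₀ i) (hpdf i)
    (.of_forall fun w => (measurable_prod_clearanceCDF d w _).aestronglyMeasurable)
    (.of_forall fun w s => prod_clearanceCDF_mem d w _ s) fun s => ?_
  refine tendsto_finsetProd _ fun j _ => ?_
  exact tendsto_setIntegral_density measurableSet_Iic
    (.of_forall fun w s => (clearancePDF_pos d w j s).le)
    (.of_forall fun w => integrable_clearancePDF d w j)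
    (.of_forall fun w => integral_clearancePDF d w j)
    (fun s => (clearancePDF_pos d w₀ j s).le) (integrable_clearancePDF d w₀ j)
    (integral_clearancePDF d w₀ j) (hpdf j)

lemma scaledErlangPDF_nonneg {p : ℝ} (hp : 0 ≤ p) (N m : ℕ) (s : ℝ) :
    0 ≤ scaledErlangPDF p N m s := by
  unfold scaledErlangPDF
  split_ifs with h
  · exact mul_nonneg (Real.sqrt_nonneg _) (erlangPDF_nonneg hp m h.le)
  · exact le_rfl

lemma scaledErlangCDF_mem {p : ℝ} (hp : 0 ≤ p) (N m : ℕ) (s : ℝ) :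
    scaledErlangCDF p N m s ∈ Set.Icc (0 : ℝ) 1 := by
  unfold scaledErlangCDF
  split_ifs with h
  · exact ⟨erlangCDF_nonneg hp m h.le, erlangCDF_le_one hp m h.le⟩
  · exact ⟨le_rfl, zero_le_one⟩

lemma measurable_scaledErlangCDF (p : ℝ) (N m : ℕ) : Measurable (scaledErlangCDF p N m) := by
  refine Measurable.ite (measurableSet_lt measurable_const (by fun_prop)) ?_ measurable_const
  exact (continuous_erlangCDF p m).measurable.comp (by fun_prop)

lemma integrable_scaledErlangPDF {p : ℝ} (hp : 0 < p) {N : ℕ} (hN : N ≠ 0) (m : ℕ) :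
    Integrable (scaledErlangPDF p N m) := by
  have hN' : √(N : ℝ) ≠ 0 := by positivity
  have h := (integrable_indicator_iff measurableSet_Ioi).2 (integrableOn_erlangPDF hp m)
  have h2 := ((h.comp_add_left (N : ℝ)).comp_mul_right' hN').const_mul √(N : ℝ)
  refine h2.congr (.of_forall fun s => ?_)
  simp only [scaledErlangPDF, Set.indicator, Set.mem_Ioi]
  split_ifs <;> simp

lemma integral_scaledErlangPDF {p : ℝ} (hp : 0 < p) {N m : ℕ} (hN : N ≠ 0) (hm : m ≠ 0) :
    ∫ s, scaledErlangPDF p N m s = 1 := by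
  have hN' : 0 < √(N : ℝ) := by positivity
  rw [← integral_erlangPDF hp hm, ← integral_indicator measurableSet_Ioi]
  refine Eq.trans ?_ (integral_comp_affine _ (N : ℝ) hN')
  refine integral_congr_ae (.of_forall fun s => ?_)
  simp only [scaledErlangPDF, Set.indicator, Set.mem_Ioi]
  split_ifs <;> simp

lemma setIntegral_scaledErlangPDF (p : ℝ) {N m : ℕ} (hN : N ≠ 0) (hm : m ≠ 0) (s : ℝ) :
    ∫ u in Set.Iic s, scaledErlangPDF p N m u = scaledErlangCDF p N m s := by
  have hN' : 0 < √(N : ℝ) := by positivity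
  have h1 : ∫ u in Set.Iic s, scaledErlangPDF p N m u =
      ∫ t in Set.Ioc 0 (N + s * √N), erlangPDF p m t := by
    rw [← integral_indicator measurableSet_Iic, ← integral_indicator measurableSet_Ioc]
    refine Eq.trans ?_ (integral_comp_affine _ (N : ℝ) hN')
    refine integral_congr_ae (.of_forall fun u => ?_)
    have : N + u * √N ≤ N + s * √N ↔ u ≤ s := by
      rw [add_le_add_iff_left, mul_le_mul_iff_left₀ hN']
    simp only [scaledErlangPDF, Set.indicator, Set.mem_Iic, Set.mem_Ioc, this]
    split_ifs <;> simp_all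
  rw [h1, scaledErlangCDF]
  split_ifs with h
  · exact integral_erlangPDF_Ioc hm h.le
  · rw [Set.Ioc_eq_empty h, setIntegral_empty]

lemma lastBinProb_eq_integral_scaled (d : Die k) {N : ℕ} (hN : N ≠ 0) (ζ : Fin k → ℕ)
    (i : Fin k) :
    lastBinProb d ζ i = ∫ s, scaledErlangPDF (d.prob i) N (ζ i) s *
      ∏ j ∈ Finset.univ.erase i, scaledErlangCDF (d.prob j) N (ζ j) s := by
  have hN' : 0 < √(N : ℝ) := by positivity
  rw [lastBinProb_eq, ← integral_indicator measurableSet_Ioi,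
    ← integral_comp_affine _ (N : ℝ) hN']
  refine integral_congr_ae (.of_forall fun s => ?_)
  simp only [scaledErlangPDF, scaledErlangCDF, Set.indicator, Set.mem_Ioi]
  split_ifs <;> simp [mul_assoc]

section Limits

variable {ι : Type*} {l : Filter ι} {N : ι → ℕ}

lemma eventually_ne_zero_of_tendsto_rescaled (hN : Tendsto N l atTop) {p : ℝ} (hp : 0 < p)
    {m : ι → ℕ} {w : ℝ} (hm : Tendsto (fun a => ((m a : ℝ) - p * N a) / √(N a)) l (𝓝 w)) :
    ∀ᶠ a in l, m a ≠ 0 := by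
  have hNr : Tendsto (fun a => √(N a : ℝ)) l atTop :=
    Real.tendsto_sqrt_atTop.comp (tendsto_natCast_atTop_atTop.comp hN)
  have h : Tendsto (fun a => p * √(N a : ℝ)) l atTop := hNr.const_mul_atTop hp
  filter_upwards [h.eventually_gt_atTop (1 - w), hm.eventually_const_lt (sub_one_lt w),
    hNr.eventually_gt_atTop 0] with a h1 h2 h3 h4
  have h5 : ((m a : ℝ) - p * N a) / √(N a) = -(p * √(N a)) := by
    rw [h4, div_eq_iff h3.ne']
    have := Real.mul_self_sqrt (Nat.cast_nonneg (α := ℝ) (N a))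
    push_cast
    linear_combination p * this
  linarith

lemma eventually_pos_affine (hN : Tendsto N l atTop) (s : ℝ) :
    ∀ᶠ a in l, 0 < (N a : ℝ) + s * √(N a) := by
  have hNr : Tendsto (fun a => √(N a : ℝ)) l atTop :=
    Real.tendsto_sqrt_atTop.comp (tendsto_natCast_atTop_atTop.comp hN)
  filter_upwards [hNr.eventually_gt_atTop 0, hNr.eventually_gt_atTop (-s)] with a h1 h2
  have h3 := Real.mul_self_sqrt (Nat.cast_nonneg (α := ℝ) (N a))
  have : 0 < √(N a : ℝ) * (√(N a) + s) := mul_pos h1 (by linarith)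
  linarith

lemma tendsto_scaledErlangPDF (hN : Tendsto N l atTop) {p : ℝ} (hp : 0 < p) {m : ι → ℕ} {w : ℝ}
    (hm : Tendsto (fun a => ((m a : ℝ) - p * N a) / √(N a)) l (𝓝 w)) (s : ℝ) :
    Tendsto (fun a => scaledErlangPDF p (N a) (m a) s) l
      (𝓝 (gaussianPDFReal (w / p) (Real.toNNReal p⁻¹) s)) := by
  refine (tendsto_erlangPDF_gaussian hp hN hm s).congr' ?_
  filter_upwards [eventually_pos_affine hN s] with a ha
  rw [scaledErlangPDF, if_pos ha]

lemma tendsto_integral_scaledErlangPDF_mul [l.IsCountablyGenerated] (hN : Tendsto N l atTop)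
    {p : ℝ} (hp : 0 < p) {m : ι → ℕ} {w : ℝ}
    (hm : Tendsto (fun a => ((m a : ℝ) - p * N a) / √(N a)) l (𝓝 w)) {P : ι → ℝ → ℝ} {P₀ : ℝ → ℝ}
    (hPm : ∀ a, Measurable (P a)) (hP : ∀ a x, P a x ∈ Set.Icc (0 : ℝ) 1)
    (hPlim : ∀ x, Tendsto (fun a => P a x) l (𝓝 (P₀ x))) :
    Tendsto (fun a => ∫ s, scaledErlangPDF p (N a) (m a) s * P a s) l
      (𝓝 (∫ s, gaussianPDFReal (w / p) (Real.toNNReal p⁻¹) s * P₀ s)) := by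
  have hv : Real.toNNReal p⁻¹ ≠ 0 := (Real.toNNReal_pos.2 (inv_pos.2 hp)).ne'
  refine tendsto_integral_density_mul
    (.of_forall fun a s => scaledErlangPDF_nonneg hp.le _ _ s) ?_ ?_
    (fun s => gaussianPDFReal_nonneg _ _ s) (integrable_gaussianPDFReal _ _)
    (integral_gaussianPDFReal_eq_one _ hv) (tendsto_scaledErlangPDF hN hp hm)
    (.of_forall fun a => (hPm a).aestronglyMeasurable) (.of_forall hP) hPlim
  · filter_upwards [hN.eventually_ne_atTop 0] with a ha
    exact integrable_scaledErlangPDF hp ha _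
  · filter_upwards [hN.eventually_ne_atTop 0,
      eventually_ne_zero_of_tendsto_rescaled hN hp hm] with a ha hma
    exact integral_scaledErlangPDF hp ha hma

lemma tendsto_scaledErlangCDF [l.IsCountablyGenerated] (hN : Tendsto N l atTop) {p : ℝ}
    (hp : 0 < p) {m : ι → ℕ} {w : ℝ}
    (hm : Tendsto (fun a => ((m a : ℝ) - p * N a) / √(N a)) l (𝓝 w)) (s : ℝ) :
    Tendsto (fun a => scaledErlangCDF p (N a) (m a) s) l
      (𝓝 (∫ u in Set.Iic s, gaussianPDFReal (w / p) (Real.toNNReal p⁻¹) u)) := by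
  have h := tendsto_integral_scaledErlangPDF_mul hN hp hm
    (P := fun _ => (Set.Iic s).indicator 1) (P₀ := (Set.Iic s).indicator 1)
    (fun _ => measurable_one.indicator measurableSet_Iic)
    (fun _ x => ⟨Set.indicator_nonneg (fun _ _ => zero_le_one) x,
      Set.indicator_le_self' (fun _ _ => zero_le_one) x⟩) (fun x => tendsto_const_nhds)
  simp only [← Set.indicator_mul_right, Pi.one_apply, mul_one,
    integral_indicator measurableSet_Iic] at h
  refine h.congr' ?_
  filter_upwards [hN.eventually_ne_atTop 0,
    eventually_ne_zero_of_tendsto_rescaled hN hp hm] with a ha hma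
  exact setIntegral_scaledErlangPDF p ha hma s

/-- The probability that a given bin is cleared last converges to its Gaussian counterpart. -/
theorem tendsto_lastBinProb [l.IsCountablyGenerated] (d : Die k) (hN : Tendsto N l atTop)
    {ζ : ι → Fin k → ℕ} {w : Fin k → ℝ}
    (hζ : ∀ j, Tendsto (fun a => ((ζ a j : ℝ) - d.prob j * N a) / √(N a)) l (𝓝 (w j)))
    (i : Fin k) :
    Tendsto (fun a => lastBinProb d (ζ a) i) l (𝓝 (argmaxProb d w i)) := by
  have h := tendsto_integral_scaledErlangPDF_mul hN (d.prob_pos i) (hζ i)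
    (P := fun a s => ∏ j ∈ Finset.univ.erase i, scaledErlangCDF (d.prob j) (N a) (ζ a j) s)
    (P₀ := fun s => ∏ j ∈ Finset.univ.erase i, clearanceCDF d w j s)
    (fun a => Finset.measurable_fun_prod _ fun j _ => measurable_scaledErlangCDF _ _ _)
    (fun a s => ⟨Finset.prod_nonneg fun j _ => (scaledErlangCDF_mem (d.prob_pos j).le _ _ s).1,
      Finset.prod_le_one (fun j _ => (scaledErlangCDF_mem (d.prob_pos j).le _ _ s).1)
        fun j _ => (scaledErlangCDF_mem (d.prob_pos j).le _ _ s).2⟩)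
    (fun s => tendsto_finsetProd _ fun j _ =>
      tendsto_scaledErlangCDF hN (d.prob_pos j) (hζ j) s)
  refine h.congr' ?_
  filter_upwards [hN.eventually_ne_atTop 0] with a ha
  exact (lastBinProb_eq_integral_scaled d ha (ζ a) i).symm

lemma tendsto_setIntegral_Iic_gaussianPDFReal {p : ℝ} (hp : 0 < p) (s : ℝ) :
    Tendsto (fun C : ℝ => ∫ u in Set.Iic s, gaussianPDFReal (C / p) (Real.toNNReal p⁻¹) u)
      atTop (𝓝 0) := by
  have hv : Real.toNNReal p⁻¹ ≠ 0 := (Real.toNNReal_pos.2 (inv_pos.2 hp)).ne'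
  have h1 : ∀ C : ℝ, ∫ u in Set.Iic s, gaussianPDFReal (C / p) (Real.toNNReal p⁻¹) u
      = (gaussianReal 0 (Real.toNNReal p⁻¹)).real (Set.Iic (s - C / p)) := by
    intro C
    have h2 := gaussianReal_map_add_const (μ := 0) (v := Real.toNNReal p⁻¹) (C / p)
    rw [zero_add] at h2
    have h3 : (gaussianReal (C / p) (Real.toNNReal p⁻¹)).real (Set.Iic s)
        = (gaussianReal 0 (Real.toNNReal p⁻¹)).real (Set.Iic (s - C / p)) := by
      rw [← h2, map_measureReal_apply (by fun_prop) measurableSet_Iic]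
      congr 1
      ext x
      simp [le_sub_iff_add_le]
    rw [← h3, Measure.real, gaussianReal_apply_eq_integral _ hv, ENNReal.toReal_ofReal]
    exact setIntegral_nonneg measurableSet_Iic fun u _ => gaussianPDFReal_nonneg _ _ u
  simp only [h1]
  have h4 : Tendsto (fun C : ℝ => s - C / p) atTop atBot :=
    tendsto_atBot_add_const_left _ _ (tendsto_neg_atTop_atBot.comp (tendsto_id.atTop_div_const hp))
  have h5 : Tendsto (fun x => (gaussianReal 0 (Real.toNNReal p⁻¹)).real (Set.Iic x)) atBot
      (𝓝 0) := by
    have h6 := tendsto_cdf_atBot (gaussianReal 0 (Real.toNNReal p⁻¹))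
    exact h6.congr fun x => cdf_eq_real _ x
  exact h5.comp h4

/-- If a bin receives far more than `p N` tokens on the scale `√N`, it is not cleared by time
`N + s √N`. -/
lemma tendsto_scaledErlangCDF_zero [l.IsCountablyGenerated] (hN : Tendsto N l atTop) {p : ℝ}
    (hp : 0 < p) {m : ι → ℕ}
    (hm : Tendsto (fun a => ((m a : ℝ) - p * N a) / √(N a)) l atTop) (s : ℝ) :
    Tendsto (fun a => scaledErlangCDF p (N a) (m a) s) l (𝓝 0) := by
  refine tendsto_order.2 ⟨fun c hc => .of_forall fun a =>
    hc.trans_le (scaledErlangCDF_mem hp.le _ _ s).1, fun ε hε => ?_⟩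
  obtain ⟨C, hC, hC0⟩ := (((tendsto_setIntegral_Iic_gaussianPDFReal hp s).eventually_lt_const
    hε).and (eventually_ge_atTop 0)).exists
  have hNr : Tendsto (fun a => √(N a : ℝ)) l atTop :=
    Real.tendsto_sqrt_atTop.comp (tendsto_natCast_atTop_atTop.comp hN)
  -- Compare with `b` tokens, `b ≈ p N + C √N`, where the Gaussian limit is known.
  set b : ι → ℕ := fun a => ⌊p * N a + C * √(N a)⌋₊ with hb
  have hbt : Tendsto (fun a => ((b a : ℝ) - p * N a) / √(N a)) l (𝓝 C) := by
    have hlow : Tendsto (fun a => C - (√(N a : ℝ))⁻¹) l (𝓝 C) := by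
      simpa using tendsto_const_nhds.sub (tendsto_inv_atTop_zero.comp hNr)
    refine tendsto_of_tendsto_of_tendsto_of_le_of_le' hlow tendsto_const_nhds ?_ ?_
    · filter_upwards [hNr.eventually_gt_atTop 0] with a ha
      rw [le_div_iff₀ ha, sub_mul, inv_mul_cancel₀ ha.ne']
      have := Nat.sub_one_lt_floor (p * N a + C * √(N a))
      simp only [hb]
      linarith
    · filter_upwards [hNr.eventually_gt_atTop 0] with a ha
      rw [div_le_iff₀ ha]
      have := Nat.floor_le (by positivity : 0 ≤ p * N a + C * √(N a))
      simp only [hb]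
      linarith
  filter_upwards [(tendsto_scaledErlangCDF hN hp hbt s).eventually_lt_const hC,
    hm.eventually_ge_atTop C, hNr.eventually_gt_atTop 0] with a h1 h2 h3
  refine lt_of_le_of_lt ?_ h1
  have hbm : b a ≤ m a := by
    rw [le_div_iff₀ h3] at h2
    refine Nat.floor_le_of_le ?_
    linarith
  unfold scaledErlangCDF
  split_ifs with h
  · exact erlangCDF_antitone hp.le h.le hbm
  · exact le_rfl

/-- A bin with about `p N` tokens is not cleared last if another bin has far more tokens. -/
lemma tendsto_lastBinProb_zero [l.IsCountablyGenerated] (d : Die k) (hN : Tendsto N l atTop)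
    {ζ : ι → Fin k → ℕ} {m : ι → ℕ} {i j : Fin k} (hij : j ≠ i) {w : ℝ}
    (hi : Tendsto (fun a => ((m a : ℝ) - d.prob i * N a) / √(N a)) l (𝓝 w))
    (hj : Tendsto (fun a => ((ζ a j : ℝ) - d.prob j * N a) / √(N a)) l atTop) :
    Tendsto (fun a => if ζ a i = m a then lastBinProb d (ζ a) i else 0) l (𝓝 0) := by
  have h := tendsto_integral_scaledErlangPDF_mul hN (d.prob_pos i) hi
    (P := fun a s => scaledErlangCDF (d.prob j) (N a) (ζ a j) s) (P₀ := fun _ => 0)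
    (fun a => measurable_scaledErlangCDF _ _ _)
    (fun a s => scaledErlangCDF_mem (d.prob_pos j).le _ _ s)
    (fun s => tendsto_scaledErlangCDF_zero hN (d.prob_pos j) hj s)
  simp only [mul_zero, integral_zero] at h
  refine tendsto_of_tendsto_of_tendsto_of_le_of_le' tendsto_const_nhds h ?_ ?_
  · refine .of_forall fun a => ?_
    split_ifs
    · exact lastBinProb_nonneg d _ i
    · exact le_rfl
  · filter_upwards [hN.eventually_ne_atTop 0] with a ha
    have hint : ∀ {P : ℝ → ℝ}, Measurable P → (∀ s, P s ∈ Set.Icc (0 : ℝ) 1) →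
        Integrable fun s => scaledErlangPDF (d.prob i) (N a) (m a) s * P s := by
      intro P hPm hP
      refine (integrable_scaledErlangPDF (d.prob_pos i) ha _).mul_bdd (c := 1)
        hPm.aestronglyMeasurable (.of_forall fun s => ?_)
      rw [Real.norm_eq_abs, abs_of_nonneg (hP s).1]
      exact (hP s).2
    have hmem := fun (j : Fin k) (s : ℝ) =>
      scaledErlangCDF_mem (d.prob_pos j).le (N a) (ζ a j) s
    split_ifs with hz
    · rw [lastBinProb_eq_integral_scaled d ha (ζ a) i, hz]
      refine integral_mono (hint
        (Finset.measurable_fun_prod _ fun j _ => measurable_scaledErlangCDF _ _ _)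
        fun s => ⟨Finset.prod_nonneg fun j _ => (hmem j s).1,
          Finset.prod_le_one (fun j _ => (hmem j s).1) fun j _ => (hmem j s).2⟩)
        (hint (measurable_scaledErlangCDF _ _ _) (hmem j)) fun s => ?_
      refine mul_le_mul_of_nonneg_left ?_ (scaledErlangPDF_nonneg (d.prob_pos i).le _ _ s)
      rw [← Finset.mul_prod_erase _ _ (Finset.mem_erase.2 ⟨hij, Finset.mem_univ j⟩)]
      exact mul_le_of_le_one_right (hmem j s).1
        (Finset.prod_le_one (fun j _ => (hmem j s).1) fun j _ => (hmem j s).2)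
    · exact integral_nonneg fun s =>
        mul_nonneg (scaledErlangPDF_nonneg (d.prob_pos i).le _ _ s) (hmem j s).1

end Limits

/-! ### The payoff of the continuous game -/

lemma Die.pos (d : Die k) : 0 < k := by
  rcases Nat.eq_zero_or_pos k with rfl | h
  · simpa using d.sum_prob
  · exact h

lemma measureReal_pi_lt {n : ℕ} (ν : Fin (n + 1) → Measure ℝ) [∀ i, IsProbabilityMeasure (ν i)]
    (i : Fin (n + 1)) :
    (Measure.pi ν).real {t | ∀ j, j ≠ i → t j < t i} =
      ∫ s, ∏ j ∈ Finset.univ.erase i, (ν j).real (Set.Iio s) ∂(ν i) := by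
  have hmeas : MeasurableSet {x : ℝ × (Fin n → ℝ) | ∀ j, x.2 j < x.1} := by
    rw [Set.ofPred_forall]
    exact MeasurableSet.iInter fun j =>
      measurableSet_lt ((measurable_pi_apply j).comp measurable_snd) measurable_fst
  have hset : {t : Fin (n + 1) → ℝ | ∀ j, j ≠ i → t j < t i} =
      MeasurableEquiv.piFinSuccAbove (fun _ => ℝ) i ⁻¹' {x | ∀ j, x.2 j < x.1} := by
    ext t
    simp only [Set.mem_ofPred_eq, Set.mem_preimage]
    constructor
    · intro h j
      exact h _ (Fin.succAbove_ne i j)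
    · intro h j hj
      obtain ⟨j', rfl⟩ := Fin.exists_succAbove_eq hj
      exact h j'
  rw [hset, (measurePreserving_piFinSuccAbove ν i).measureReal_preimage
    hmeas.nullMeasurableSet, Measure.real, Measure.prod_apply hmeas]
  have hslice : ∀ s : ℝ, Prod.mk s ⁻¹' {x : ℝ × (Fin n → ℝ) | ∀ j, x.2 j < x.1} =
      Set.univ.pi fun _ => Set.Iio s := by
    intro s
    ext f
    simp
  simp only [hslice, Measure.pi_pi]
  have hm : Measurable fun s => ∏ j, ν (i.succAbove j) (Set.Iio s) :=
    Finset.measurable_fun_prod _ fun j _ =>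
      Monotone.measurable fun s t hst => measure_mono (Set.Iio_subset_Iio hst)
  rw [← integral_toReal hm.aemeasurable (.of_forall fun s =>
    ENNReal.prod_lt_top fun j _ => measure_lt_top _ _)]
  refine integral_congr_ae (.of_forall fun s => ?_)
  beta_reduce
  rw [ENNReal.toReal_prod]
  have himg : Finset.univ.erase i = Finset.univ.map i.succAboveEmb := by
    ext j
    simp only [Finset.mem_erase, Finset.mem_univ, and_true, Finset.mem_map, true_and]
    exact ⟨fun h => Fin.exists_succAbove_eq h, fun ⟨j', h⟩ => h ▸ Fin.succAbove_ne i j'⟩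
  rw [himg, Finset.prod_map]
  rfl

lemma measure_pi_eq_coord {n : ℕ} (ν : Fin (n + 1) → Measure ℝ) [∀ i, IsProbabilityMeasure (ν i)]
    {i j : Fin (n + 1)} [NullSingletonClass (ν i)] (hij : j ≠ i) :
    Measure.pi ν {t | t i = t j} = 0 := by
  obtain ⟨j', rfl⟩ := Fin.exists_succAbove_eq hij
  have hmeas : MeasurableSet {x : ℝ × (Fin n → ℝ) | x.1 = x.2 j'} :=
    measurableSet_eq_fun measurable_fst ((measurable_pi_apply j').comp measurable_snd)
  have h := (measurePreserving_piFinSuccAbove ν i).measure_preimage hmeas.nullMeasurableSet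
  have hset : MeasurableEquiv.piFinSuccAbove (fun _ => ℝ) i ⁻¹' {x | x.1 = x.2 j'} =
      {t | t i = t (i.succAbove j')} := rfl
  rw [← hset, h, Measure.prod_apply_symm hmeas]
  have hslice : ∀ f : Fin n → ℝ,
      (fun s => (s, f)) ⁻¹' {x : ℝ × (Fin n → ℝ) | x.1 = x.2 j'} = {f j'} := by
    intro f
    ext s
    simp
  simp [hslice]

/-- The clearance time of bin `i` in the continuous game. -/
noncomputable def binTime (d : Die k) (w z : Fin k → ℝ) (i : Fin k) : ℝ :=
  w i / d.prob i + z i / √(d.prob i)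

lemma map_binTime_stdNormals (d : Die k) (w : Fin k → ℝ) :
    (stdNormals k).map (binTime d w) = Measure.pi fun j =>
      gaussianReal (w j / d.prob j) (Real.toNNReal (d.prob j)⁻¹) := by
  have hone : ∀ j, (gaussianReal 0 1).map (fun z => w j / d.prob j + z / √(d.prob j)) =
      gaussianReal (w j / d.prob j) (Real.toNNReal (d.prob j)⁻¹) := by
    intro j
    have h1 := gaussianReal_map_div_const (μ := 0) (v := 1) √(d.prob j)
    have h2 : (gaussianReal 0 1).map (fun z => w j / d.prob j + z / √(d.prob j)) =
        ((gaussianReal 0 1).map (· / √(d.prob j))).map (w j / d.prob j + ·) := by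
      rw [Measure.map_map (by fun_prop) (by fun_prop)]
      rfl
    rw [h2, h1, gaussianReal_map_const_add]
    congr 1
    · simp
    · ext
      simp [Real.sq_sqrt (d.prob_pos j).le, (d.prob_pos j).le]
  have : ∀ j, IsProbabilityMeasure
      ((gaussianReal 0 1).map (fun z => w j / d.prob j + z / √(d.prob j))) := fun j => by
    rw [hone]
    infer_instance
  rw [stdNormals]
  have h := Measure.pi_map_pi (μ := fun _ : Fin k => gaussianReal 0 1)
    (f := fun j z => w j / d.prob j + z / √(d.prob j)) fun j => by fun_prop
  simp only [hone] at h
  exact h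

lemma measurable_binTime (d : Die k) (w : Fin k → ℝ) : Measurable (binTime d w) := by
  refine measurable_pi_lambda _ fun i => ?_
  simp only [binTime]
  fun_prop

/-- The event that bin `i` is cleared strictly after all others. -/
def lastBinEvent (d : Die k) (w : Fin k → ℝ) (i : Fin k) : Set (Fin k → ℝ) :=
  {z | ∀ j, j ≠ i → binTime d w z j < binTime d w z i}

lemma measurableSet_lt_coord (i : Fin k) :
    MeasurableSet {t : Fin k → ℝ | ∀ j, j ≠ i → t j < t i} := by
  simp only [Set.ofPred_forall]
  exact MeasurableSet.iInter fun j => MeasurableSet.iInter fun _ =>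
    measurableSet_lt (measurable_pi_apply j) (measurable_pi_apply i)

lemma measurableSet_lastBinEvent (d : Die k) (w : Fin k → ℝ) (i : Fin k) :
    MeasurableSet (lastBinEvent d w i) :=
  measurable_binTime d w (measurableSet_lt_coord i)

lemma measureReal_lastBinEvent (d : Die k) (w : Fin k → ℝ) (i : Fin k) :
    (stdNormals k).real (lastBinEvent d w i) = argmaxProb d w i := by
  obtain ⟨n, rfl⟩ := Nat.exists_eq_succ_of_ne_zero d.pos.ne'
  have h : (stdNormals (n + 1)).real (lastBinEvent d w i) =
      ((stdNormals (n + 1)).map (binTime d w)).real {t | ∀ j, j ≠ i → t j < t i} :=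
    (map_measureReal_apply (measurable_binTime d w) (measurableSet_lt_coord i)).symm
  rw [h, map_binTime_stdNormals, measureReal_pi_lt, integral_gaussianReal_eq_integral_smul
    (toNNReal_inv_prob_ne_zero d i), argmaxProb]
  refine integral_congr_ae (.of_forall fun s => ?_)
  beta_reduce
  rw [smul_eq_mul]
  congr 1
  refine Finset.prod_congr rfl fun j _ => ?_
  have hv := toNNReal_inv_prob_ne_zero d j
  have := nullSingletonClass_gaussianReal (μ := w j / d.prob j) hv
  rw [Measure.real, measure_congr Iio_ae_eq_Iic, gaussianReal_apply_eq_integral _ hv,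
    ENNReal.toReal_ofReal (setIntegral_nonneg measurableSet_Iic fun u _ =>
      gaussianPDFReal_nonneg _ _ u)]
  rfl

lemma ae_exists_lastBinEvent (d : Die k) (w : Fin k → ℝ) :
    ∀ᵐ z ∂stdNormals k, ∃ i, z ∈ lastBinEvent d w i := by
  obtain ⟨n, rfl⟩ := Nat.exists_eq_succ_of_ne_zero d.pos.ne'
  have hne : ∀ i j : Fin (n + 1), j ≠ i →
      ∀ᵐ z ∂stdNormals (n + 1), binTime d w z i ≠ binTime d w z j := by
    intro i j hij
    have := nullSingletonClass_gaussianReal (μ := w i / d.prob i) (toNNReal_inv_prob_ne_zero d i)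
    have h := measure_pi_eq_coord (fun j =>
      gaussianReal (w j / d.prob j) (Real.toNNReal (d.prob j)⁻¹)) hij
    rw [← map_binTime_stdNormals, Measure.map_apply (measurable_binTime d w)
      (measurableSet_eq_fun (measurable_pi_apply i) (measurable_pi_apply j))] at h
    rw [ae_iff]
    simpa using h
  have hall : ∀ᵐ z ∂stdNormals (n + 1), ∀ i j : Fin (n + 1), j ≠ i →
      binTime d w z i ≠ binTime d w z j :=
    ae_all_iff.2 fun i => ae_all_iff.2 fun j => by
      by_cases hij : j = i
      · exact .of_forall fun z h => absurd hij h
      · filter_upwards [hne i j hij] with z hz _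
        exact hz
  filter_upwards [hall] with z hz
  obtain ⟨i, hi⟩ := Finite.exists_max (binTime d w z)
  exact ⟨i, fun j hj => lt_of_le_of_ne (hi j) (hz i j hj).symm⟩

lemma binTime_mono (d : Die k) {w w' : Fin k → ℝ} (z : Fin k → ℝ) {i : Fin k} (h : w i ≤ w' i) :
    binTime d w z i ≤ binTime d w' z i := by
  have := d.prob_pos i
  unfold binTime
  gcongr

lemma clearanceTime_lt_iff (d : Die k) {x y z : Fin k → ℝ} {i : Fin k}
    (hz : z ∈ lastBinEvent d (x ⊔ y) i) :
    clearanceTime d x z < clearanceTime d y z ↔ x i < y i := by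
  have : Nonempty (Fin k) := ⟨i⟩
  have hle : ∀ w j, binTime d w z j ≤ clearanceTime d w z := fun w j =>
    le_ciSup (f := binTime d w z) (Set.finite_range _).bddAbove j
  have hge : ∀ w, ∃ j, binTime d w z j = clearanceTime d w z := fun w =>
    exists_eq_ciSup_of_finite (f := binTime d w z)
  constructor
  · intro h
    by_contra! hxy
    obtain ⟨j, hj⟩ := hge y
    have h1 : binTime d y z j ≤ binTime d (x ⊔ y) z j := binTime_mono d z (by simp)
    have h2 : binTime d (x ⊔ y) z j ≤ binTime d (x ⊔ y) z i := by
      by_cases hji : j = i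
      · rw [hji]
      · exact (hz j hji).le
    have h3 : binTime d (x ⊔ y) z i ≤ binTime d x z i := binTime_mono d z (by simp [hxy])
    linarith [hle x i]
  · intro hxy
    obtain ⟨j, hj⟩ := hge x
    have h3 : binTime d (x ⊔ y) z i ≤ binTime d y z i := binTime_mono d z (by simp [hxy.le])
    rw [← hj]
    refine lt_of_lt_of_le ?_ (hle y i)
    by_cases hji : j = i
    · subst hji
      have := d.prob_pos j
      unfold binTime
      gcongr
    · exact (binTime_mono d z (by simp)).trans_lt ((hz j hji).trans_le h3)

lemma measureReal_clearanceTime_lt (d : Die k) (x y : Fin k → ℝ) :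
    (stdNormals k).real {z | clearanceTime d x z < clearanceTime d y z} =
      ∑ i, if x i < y i then argmaxProb d (x ⊔ y) i else 0 := by
  have hprob : IsProbabilityMeasure (stdNormals k) := by unfold stdNormals; infer_instance
  have hae : {z | clearanceTime d x z < clearanceTime d y z} =ᵐ[stdNormals k]
      ⋃ i ∈ Finset.univ.filter fun i => x i < y i, lastBinEvent d (x ⊔ y) i := by
    rw [Filter.eventuallyEq_set]
    filter_upwards [ae_exists_lastBinEvent d (x ⊔ y)] with z ⟨i, hi⟩
    simp only [Set.mem_iUnion, Finset.mem_filter, Finset.mem_univ, true_and,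
      exists_prop]
    exact ⟨fun h => ⟨i, (clearanceTime_lt_iff d hi).1 h, hi⟩,
      fun ⟨j, hj, hzj⟩ => (clearanceTime_lt_iff d hzj).2 hj⟩
  rw [measureReal_congr hae, measureReal_biUnion_finset]
  · rw [Finset.sum_filter]
    exact Finset.sum_congr rfl fun i _ => by rw [measureReal_lastBinEvent]
  · intro i _ j _ hij
    refine Set.disjoint_left.2 fun z hi hj => ?_
    exact lt_asymm (hi j hij.symm) (hj i hij)
  · exact fun i _ => measurableSet_lastBinEvent d _ i

/-- The sign-weighted formula for the payoff. It mirrors `tokenPayoff_eq`, and shows that the payoff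
is continuous away from the pairs that agree in some coordinate. -/
lemma payoff_eq (d : Die k) (x y : Deviation k) :
    payoff d x y =
      (∑ i, SignType.sign (y.1 i - x.1 i) * argmaxProb d (x.1 ⊔ y.1) i) / 2 := by
  rw [payoff, measureReal_clearanceTime_lt, measureReal_clearanceTime_lt, sup_comm y.1, ←
    Finset.sum_sub_distrib]
  congr 1
  refine Finset.sum_congr rfl fun i _ => ?_
  rcases lt_trichotomy (x.1 i) (y.1 i) with h | h | h
  · simp [h, h.not_gt, sign_pos (sub_pos.2 h)]
  · simp [h]
  · simp [h, h.not_gt, sign_neg (sub_neg.2 h)]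

/-! ### Optimal strategies of the continuous game -/

lemma measurable_sign_real : Measurable fun r : ℝ => ((SignType.sign r : SignType) : ℝ) := by
  have h : (fun r : ℝ => ((SignType.sign r : SignType) : ℝ)) =
      fun r => if 0 < r then 1 else if r < 0 then -1 else 0 := by
    funext r
    rw [sign_apply]
    split_ifs <;> simp
  rw [h]
  exact Measurable.ite measurableSet_Ioi measurable_const
    (Measurable.ite measurableSet_Iio measurable_const measurable_const)

lemma measurable_payoff (d : Die k) :
    Measurable fun z : Deviation k × Deviation k => payoff d z.1 z.2 := by
  have hfst : ∀ i, Measurable fun z : Deviation k × Deviation k => z.1.1 i := fun i =>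
    (measurable_pi_apply i).comp (measurable_subtype_coe.comp measurable_fst)
  have hsnd : ∀ i, Measurable fun z : Deviation k × Deviation k => z.2.1 i := fun i =>
    (measurable_pi_apply i).comp (measurable_subtype_coe.comp measurable_snd)
  have h : Measurable fun z : Deviation k × Deviation k =>
      (∑ i, ((SignType.sign (z.2.1 i - z.1.1 i) : SignType) : ℝ) *
        argmaxProb d (z.1.1 ⊔ z.2.1) i) / 2 := by
    refine (Finset.measurable_fun_sum _ fun i _ => ?_).div_const _
    refine (measurable_sign_real.comp ((hsnd i).sub (hfst i))).mul ?_
    exact (continuous_argmaxProb d i).measurable.comp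
      (measurable_pi_lambda _ fun j => (hfst j).sup (hsnd j))
  have heq := funext fun z : Deviation k × Deviation k => payoff_eq d z.1 z.2
  rwa [heq]

lemma measurable_payoff_left (d : Die k) (y : Deviation k) :
    Measurable fun x => payoff d x y := by
  have h : Measurable fun x : Deviation k => (x, y) := measurable_id.prodMk measurable_const
  have h2 := Measurable.comp (measurable_payoff d) h
  simpa only [Function.comp_def] using h2

lemma payoff_swap (d : Die k) (x y : Deviation k) : payoff d y x = -payoff d x y := by
  rw [payoff, payoff]
  ring

lemma payoff_self (d : Die k) (x : Deviation k) : payoff d x x = 0 := by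
  simp [payoff]

lemma abs_payoff_le (d : Die k) (x y : Deviation k) : |payoff d x y| ≤ 1 := by
  have : IsProbabilityMeasure (stdNormals k) := by unfold stdNormals; infer_instance
  have h : ∀ s : Set (Fin k → ℝ), 0 ≤ (stdNormals k).real s ∧ (stdNormals k).real s ≤ 1 :=
    fun s => ⟨measureReal_nonneg, measureReal_le_one⟩
  rw [payoff, abs_le]
  have h1 := h {z | clearanceTime d x.1 z < clearanceTime d y.1 z}
  have h2 := h {z | clearanceTime d y.1 z < clearanceTime d x.1 z}
  constructor <;> linarith [h1.1, h1.2, h2.1, h2.2]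

section Optimal

variable {d : Die k} {α₀ : ProbabilityMeasure (Deviation k)}

lemma IsOptimal.integral_payoff_nonneg (h : IsOptimal d α₀) (y : Deviation k) :
    0 ≤ ∫ x, payoff d x y ∂(α₀ : Measure (Deviation k)) := by
  have h1 : ∫ x, ∫ y', payoff d y' x ∂(Measure.dirac y) ∂(α₀ : Measure (Deviation k)) ≤ 0 :=
    not_lt.1 (h ⟨Measure.dirac y, inferInstance⟩)
  have h2 : ∀ x, ∫ y', payoff d y' x ∂(Measure.dirac y) = -payoff d x y := fun x => by
    rw [integral_dirac' _ _ (measurable_payoff_left d x).stronglyMeasurable, payoff_swap]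
  simp only [h2, integral_neg] at h1
  linarith

lemma IsOptimal.ae_integral_payoff_eq_zero (h : IsOptimal d α₀) :
    ∀ᵐ y ∂(α₀ : Measure (Deviation k)),
      ∫ x, payoff d x y ∂(α₀ : Measure (Deviation k)) = 0 := by
  have hint : Integrable (fun z : Deviation k × Deviation k => payoff d z.1 z.2)
      ((α₀ : Measure (Deviation k)).prod α₀) :=
    .of_bound (measurable_payoff d).aestronglyMeasurable 1 (.of_forall fun z => abs_payoff_le d _ _)
  have hswap := integral_integral_swap (f := fun x y => payoff d x y) hint
  have hzero : ∫ y, ∫ x, payoff d x y ∂(α₀ : Measure (Deviation k)) ∂(α₀ : Measure (Deviation k))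
      = 0 := by
    have h1 : ∫ x, ∫ y, payoff d x y ∂(α₀ : Measure (Deviation k)) ∂(α₀ : Measure (Deviation k))
        = -∫ x, ∫ y, payoff d y x ∂(α₀ : Measure (Deviation k)) ∂(α₀ : Measure (Deviation k)) := by
      rw [← integral_neg]
      refine integral_congr_ae (.of_forall fun x => ?_)
      beta_reduce
      rw [← integral_neg]
      exact integral_congr_ae (.of_forall fun y => payoff_swap d y x)
    linarith
  exact (integral_eq_zero_iff_of_nonneg (fun y => h.integral_payoff_nonneg y)
    hint.integral_prod_right).1 hzero

/-- The probability that the last bin to be cleared is bin `i` and holds equally much for the pure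
strategy `y` and for a random strategy of law `α₀`. -/
noncomputable def tieProb (d : Die k) (α₀ : ProbabilityMeasure (Deviation k)) (y : Deviation k)
    (i : Fin k) : ℝ :=
  ∫ x, (if x.1 i = y.1 i then argmaxProb d (x.1 ⊔ y.1) i else 0) ∂(α₀ : Measure (Deviation k))

lemma measurable_tie (d : Die k) (y : Deviation k) (i : Fin k) :
    Measurable fun x : Deviation k =>
      if x.1 i = y.1 i then argmaxProb d (x.1 ⊔ y.1) i else 0 := by
  have hc : ∀ i, Measurable fun x : Deviation k => x.1 i := fun i =>
    (measurable_pi_apply i).comp measurable_subtype_coe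
  refine Measurable.ite ((hc i) (measurableSet_singleton _)) ?_ measurable_const
  exact (continuous_argmaxProb d i).measurable.comp
    (measurable_pi_lambda _ fun j => (hc j).sup measurable_const)

lemma integrable_tie (d : Die k) (α₀ : ProbabilityMeasure (Deviation k)) (y : Deviation k)
    (i : Fin k) :
    Integrable (fun x : Deviation k =>
      if x.1 i = y.1 i then argmaxProb d (x.1 ⊔ y.1) i else 0) (α₀ : Measure (Deviation k)) := by
  refine .of_bound (measurable_tie d y i).aestronglyMeasurable 1 (.of_forall fun x => ?_)
  split_ifs
  · rw [Real.norm_eq_abs, abs_of_pos (argmaxProb_pos d _ i)]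
    exact argmaxProb_le_one d _ i
  · simp

lemma tieProb_pos {y : Deviation k} {i : Fin k}
    (h : (α₀ : Measure (Deviation k)) {x | x.1 i = y.1 i} ≠ 0) : 0 < tieProb d α₀ y i := by
  refine (integral_pos_iff_support_of_nonneg (fun x => ?_) (integrable_tie d α₀ y i)).2 ?_
  · beta_reduce
    split_ifs
    exacts [(argmaxProb_pos d _ i).le, le_rfl]
  · refine (pos_iff_ne_zero.2 h).trans_le (measure_mono fun x hx => ?_)
    have hx' : x.1 i = y.1 i := hx
    simp [hx', (argmaxProb_pos d _ i).ne']

lemma tendsto_sign_perturb (u v : ℝ) :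
    Tendsto (fun n : ℕ => ((SignType.sign (u + v * ((n : ℝ) + 1)⁻¹) : SignType) : ℝ)) atTop
      (𝓝 (((SignType.sign u : SignType) : ℝ) +
        if u = 0 then ((SignType.sign v : SignType) : ℝ) else 0)) := by
  have hinv : Tendsto (fun n : ℕ => ((n : ℝ) + 1)⁻¹) atTop (𝓝 0) := by
    simpa using tendsto_one_div_add_atTop_nhds_zero_nat (𝕜 := ℝ)
  have ht : Tendsto (fun n : ℕ => u + v * ((n : ℝ) + 1)⁻¹) atTop (𝓝 u) := by
    simpa using tendsto_const_nhds.add (hinv.const_mul v)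
  refine tendsto_const_nhds.congr' ?_
  rcases lt_trichotomy u 0 with h | h | h
  · filter_upwards [ht.eventually_lt_const h] with n hn
    simp [h, h.ne, hn]
  · subst h
    refine .of_forall fun n => ?_
    have hp : (0 : ℝ) < ((n : ℝ) + 1)⁻¹ := by positivity
    rcases lt_trichotomy v 0 with hv | hv | hv
    · simp [hv, mul_neg_of_neg_of_pos hv hp]
    · simp [hv]
    · simp [hv, mul_pos hv hp]
  · filter_upwards [ht.eventually_const_lt h] with n hn
    simp [h, h.ne', hn]

/-- Moving a best reply `y` infinitesimally in the direction `v` breaks its ties against `α₀`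
according to the signs of `v`. As the moved strategy does not beat `α₀`, this bounds the tie
probabilities. -/
lemma IsOptimal.sum_sign_mul_tieProb_nonneg (h : IsOptimal d α₀) {y : Deviation k}
    (hy : ∫ x, payoff d x y ∂(α₀ : Measure (Deviation k)) = 0) {v : Fin k → ℝ}
    (hv : ∑ i, v i = 0) :
    0 ≤ ∑ i, ((SignType.sign (v i) : SignType) : ℝ) * tieProb d α₀ y i := by
  set Y : ℕ → Deviation k := fun n => ⟨fun i => y.1 i + v i * ((n : ℝ) + 1)⁻¹, by
    rw [Finset.sum_add_distrib, ← Finset.sum_mul, hv, y.2]; simp⟩ with hY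
  have hYt : ∀ i, Tendsto (fun n => (Y n).1 i) atTop (𝓝 (y.1 i)) := by
    intro i
    have hinv : Tendsto (fun n : ℕ => ((n : ℝ) + 1)⁻¹) atTop (𝓝 0) := by
      simpa using tendsto_one_div_add_atTop_nhds_zero_nat (𝕜 := ℝ)
    simpa [hY] using tendsto_const_nhds.add (hinv.const_mul (v i))
  have hpt : ∀ x, Tendsto (fun n => payoff d x (Y n)) atTop (𝓝 (payoff d x y +
      (∑ i, ((SignType.sign (v i) : SignType) : ℝ) *
        (if x.1 i = y.1 i then argmaxProb d (x.1 ⊔ y.1) i else 0)) / 2)) := by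
    intro x
    have hterm : ∀ i, Tendsto (fun n => ((SignType.sign ((Y n).1 i - x.1 i) : SignType) : ℝ) *
        argmaxProb d (x.1 ⊔ (Y n).1) i) atTop
        (𝓝 ((((SignType.sign (y.1 i - x.1 i) : SignType) : ℝ) +
          if y.1 i - x.1 i = 0 then ((SignType.sign (v i) : SignType) : ℝ) else 0) *
            argmaxProb d (x.1 ⊔ y.1) i)) := by
      intro i
      refine Tendsto.mul ?_ (((continuous_argmaxProb d i).tendsto _).comp
        (tendsto_pi_nhds.2 fun j => tendsto_const_nhds.max (hYt j)))
      refine (tendsto_sign_perturb (y.1 i - x.1 i) (v i)).congr fun n => ?_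
      simp only [hY]
      congr 2
      ring
    have hsum := (tendsto_finsetSum Finset.univ fun i _ => hterm i).div_const 2
    simp only [payoff_eq]
    convert hsum using 2
    rw [← add_div, ← Finset.sum_add_distrib]
    congr 1
    refine Finset.sum_congr rfl fun i _ => ?_
    by_cases hi : x.1 i = y.1 i
    · simp [hi]
    · have : y.1 i - x.1 i ≠ 0 := sub_ne_zero.2 (Ne.symm hi)
      simp [hi, this]
  have hlim := tendsto_integral_of_dominated_convergence (μ := (α₀ : Measure (Deviation k)))
    (fun _ => (1 : ℝ)) (fun n => (measurable_payoff_left d (Y n)).aestronglyMeasurable)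
    (integrable_const 1) (fun n => .of_forall fun x => abs_payoff_le d x (Y n))
    (.of_forall hpt)
  have hge := ge_of_tendsto' hlim fun n => h.integral_payoff_nonneg (Y n)
  have hi : ∀ i, Integrable (fun x : Deviation k => ((SignType.sign (v i) : SignType) : ℝ) *
      (if x.1 i = y.1 i then argmaxProb d (x.1 ⊔ y.1) i else 0))
      (α₀ : Measure (Deviation k)) := fun i => (integrable_tie d α₀ y i).const_mul _
  have hp : Integrable (fun x => payoff d x y) (α₀ : Measure (Deviation k)) :=
    .of_bound (measurable_payoff_left d y).aestronglyMeasurable 1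
      (.of_forall fun x => abs_payoff_le d x y)
  rw [integral_add hp ((integrable_finsetSum _ fun i _ => hi i).div_const 2), hy, zero_add,
    integral_div, integral_finsetSum _ fun i _ => hi i] at hge
  simp only [integral_const_mul] at hge
  have h2 : 0 ≤ (∑ i, ((SignType.sign (v i) : SignType) : ℝ) * tieProb d α₀ y i) / 2 := hge
  linarith

lemma IsOptimal.tieProb_le (h : IsOptimal d α₀) {y : Deviation k}
    (hy : ∫ x, payoff d x y ∂(α₀ : Measure (Deviation k)) = 0) {i j : Fin k} (hij : i ≠ j) :
    tieProb d α₀ y i ≤ tieProb d α₀ y j := by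
  have h1 := h.sum_sign_mul_tieProb_nonneg hy (v := fun l =>
    (if l = j then 1 else 0) - (if l = i then 1 else 0)) (by simp [Finset.sum_sub_distrib])
  have h2 : ∀ l, ((SignType.sign ((if l = j then (1 : ℝ) else 0) - (if l = i then 1 else 0)) :
      SignType) : ℝ) * tieProb d α₀ y l =
      (if l = j then tieProb d α₀ y l else 0) - (if l = i then tieProb d α₀ y l else 0) := by
    intro l
    by_cases hlj : l = j
    · simp [hlj, hij.symm]
    · by_cases hli : l = i <;> simp [hlj, hli, hij]
  simp only [h2, Finset.sum_sub_distrib, Finset.sum_ite_eq', Finset.mem_univ, if_true] at h1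
  linarith

lemma IsOptimal.tieProb_add_le (h : IsOptimal d α₀) {y : Deviation k}
    (hy : ∫ x, payoff d x y ∂(α₀ : Measure (Deviation k)) = 0) {i j m : Fin k} (hij : i ≠ j)
    (him : i ≠ m) (hjm : j ≠ m) :
    tieProb d α₀ y i + tieProb d α₀ y m ≤ tieProb d α₀ y j := by
  have h1 := h.sum_sign_mul_tieProb_nonneg hy (v := fun l =>
    (if l = j then 2 else 0) - (if l = i then 1 else 0) - (if l = m then 1 else 0)) (by
      simp only [Finset.sum_sub_distrib, Finset.sum_ite_eq', Finset.mem_univ, if_true]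
      norm_num)
  have h2 : ∀ l, ((SignType.sign ((if l = j then (2 : ℝ) else 0) - (if l = i then 1 else 0) -
      (if l = m then 1 else 0)) : SignType) : ℝ) * tieProb d α₀ y l =
      (if l = j then tieProb d α₀ y l else 0) - (if l = i then tieProb d α₀ y l else 0) -
        (if l = m then tieProb d α₀ y l else 0) := by
    intro l
    by_cases hlj : l = j
    · subst hlj
      simp [hij.symm, hjm]
    · by_cases hli : l = i
      · subst hli
        simp [hij, him]
      · by_cases hlm : l = m
        · subst hlm
          simp [hjm.symm, him.symm]
        · simp [hlj, hli, hlm]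
  simp only [h2, Finset.sum_sub_distrib, Finset.sum_ite_eq', Finset.mem_univ, if_true] at h1
  linarith

/-- For at least three bins, the coordinates of an optimal strategy have no atoms. -/
theorem IsOptimal.measure_coord_eq_zero (h : IsOptimal d α₀) (hk : 3 ≤ k) (i : Fin k) (a : ℝ) :
    (α₀ : Measure (Deviation k)) {x | x.1 i = a} = 0 := by
  by_contra hpos
  obtain ⟨y, hya, hy⟩ : ∃ y : Deviation k, y.1 i = a ∧
      ∫ x, payoff d x y ∂(α₀ : Measure (Deviation k)) = 0 := by
    by_contra! hno
    refine hpos (measure_mono_null (fun y hy => ?_) (ae_iff.1 h.ae_integral_payoff_eq_zero))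
    exact hno y hy
  subst hya
  obtain ⟨j, hj⟩ : ∃ j : Fin k, j ∉ ({i} : Finset (Fin k)) := by
    by_contra! hall
    have := Finset.card_le_card (fun j _ => hall j : (Finset.univ : Finset (Fin k)) ⊆ {i})
    rw [Finset.card_fin, Finset.card_singleton] at this
    omega
  obtain ⟨m, hm⟩ : ∃ m : Fin k, m ∉ ({i, j} : Finset (Fin k)) := by
    by_contra! hall
    have := Finset.card_le_card (fun j _ => hall j : (Finset.univ : Finset (Fin k)) ⊆ {i, j})
    have h2 : ({i, j} : Finset (Fin k)).card ≤ 2 := Finset.card_le_two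
    rw [Finset.card_fin] at this
    omega
  simp only [Finset.mem_singleton] at hj
  simp only [Finset.mem_insert, Finset.mem_singleton, not_or] at hm
  have h1 := h.tieProb_add_le hy (Ne.symm hj) (Ne.symm hm.1) (Ne.symm hm.2)
  have h2 := h.tieProb_le hy (Ne.symm hm.2)
  have h3 := tieProb_pos (d := d) hpos
  linarith

/-- For two bins, an atom of an optimal strategy makes the two bins equally likely to be last. -/
lemma IsOptimal.argmaxProb_eq_of_atom {d : Die 2} {α₀ : ProbabilityMeasure (Deviation 2)}
    (h : IsOptimal d α₀) {y : Deviation 2} (hpos : (α₀ : Measure (Deviation 2)) {y} ≠ 0) :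
    argmaxProb d y.1 0 = argmaxProb d y.1 1 := by
  have hy : ∫ x, payoff d x y ∂(α₀ : Measure (Deviation 2)) = 0 := by
    by_contra hno
    refine hpos (measure_mono_null (fun x hx => ?_) (ae_iff.1 h.ae_integral_payoff_eq_zero))
    rw [Set.mem_singleton_iff.1 hx]
    exact hno
  have hone : ∀ (x : Deviation 2) (i : Fin 2), x.1 i = y.1 i ↔ x = y := by
    intro x i
    constructor
    · intro hi
      have hx := x.2
      have hy := y.2
      rw [Fin.sum_univ_two] at hx hy
      ext j
      fin_cases i <;> fin_cases j <;> simp at hi ⊢ <;> linarith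
    · rintro rfl
      rfl
  have htie : ∀ i, tieProb d α₀ y i =
      argmaxProb d y.1 i * (α₀ : Measure (Deviation 2)).real {y} := by
    intro i
    have : ∀ x : Deviation 2, (if x.1 i = y.1 i then argmaxProb d (x.1 ⊔ y.1) i else 0) =
        ({y} : Set (Deviation 2)).indicator (fun _ => argmaxProb d y.1 i) x := by
      intro x
      simp only [hone, Set.indicator, Set.mem_singleton_iff]
      split_ifs with hx
      · rw [hx, sup_idem]
      · rfl
    rw [tieProb]
    simp only [this]
    rw [integral_indicator_const _ (measurableSet_singleton y), smul_eq_mul, mul_comm]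
  have heq : tieProb d α₀ y 0 = tieProb d α₀ y 1 :=
    le_antisymm (h.tieProb_le hy (by decide)) (h.tieProb_le hy (by decide))
  rw [htie, htie] at heq
  exact mul_right_cancel₀ (ENNReal.toReal_ne_zero.2 ⟨hpos, measure_ne_top _ _⟩) heq

end Optimal

/-! ### Limits of the token payoffs -/

section TokenLimits

variable {ι : Type*} {l : Filter ι} {N : ι → ℕ} {ξ η : (a : ι) → Allocation k (N a)}

lemma sign_sub_allocation (d : Die k) {n : ℕ} (hn : n ≠ 0) (ξ η : Allocation k n) (i : Fin k) :
    SignType.sign ((η.1 i : ℝ) - ξ.1 i) =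
      SignType.sign ((rescale d η).1 i - (rescale d ξ).1 i) := by
  have h : (0 : ℝ) < √n := by positivity
  have h2 : (η.1 i : ℝ) - ξ.1 i = √n * ((rescale d η).1 i - (rescale d ξ).1 i) := by
    simp only [rescale]
    field_simp
    ring
  rw [h2, sign_mul, sign_pos h, one_mul]

lemma tendsto_lastBinProb_sup [l.IsCountablyGenerated] (d : Die k) (hN : Tendsto N l atTop)
    {x y : Deviation k} (hξ : Tendsto (fun a => rescale d (ξ a)) l (𝓝 x))
    (hη : Tendsto (fun a => rescale d (η a)) l (𝓝 y)) (i : Fin k) :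
    Tendsto (fun a => lastBinProb d ((ξ a).1 ⊔ (η a).1) i) l
      (𝓝 (argmaxProb d (x.1 ⊔ y.1) i)) := by
  refine tendsto_lastBinProb d hN (fun j => ?_) i
  have h1 := tendsto_pi_nhds.1 ((continuous_subtype_val.tendsto x).comp hξ) j
  have h2 := tendsto_pi_nhds.1 ((continuous_subtype_val.tendsto y).comp hη) j
  refine (h1.max h2).congr fun a => ?_
  simp only [Function.comp, rescale, Pi.sup_apply]
  rw [max_div_div_right (Real.sqrt_nonneg _), max_sub_sub_right]
  push_cast
  rfl

lemma tendsto_tokenPayoff [l.IsCountablyGenerated] (d : Die k) (hN : Tendsto N l atTop)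
    {x y : Deviation k} (hξ : Tendsto (fun a => rescale d (ξ a)) l (𝓝 x))
    (hη : Tendsto (fun a => rescale d (η a)) l (𝓝 y)) (hxy : ∀ i, x.1 i ≠ y.1 i) :
    Tendsto (fun a => tokenPayoff d (ξ a) (η a)) l (𝓝 (payoff d x y)) := by
  simp only [tokenPayoff_eq, payoff_eq]
  refine Tendsto.div_const (tendsto_finsetSum _ fun i _ => ?_) 2
  refine Tendsto.mul ?_ (tendsto_lastBinProb_sup d hN hξ hη i)
  have h1 : Tendsto (fun a => (rescale d (ξ a)).1 i) l (𝓝 (x.1 i)) :=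
    tendsto_pi_nhds.1 ((continuous_subtype_val.tendsto x).comp hξ) i
  have h2 : Tendsto (fun a => (rescale d (η a)).1 i) l (𝓝 (y.1 i)) :=
    tendsto_pi_nhds.1 ((continuous_subtype_val.tendsto y).comp hη) i
  have hne : y.1 i - x.1 i ≠ 0 := sub_ne_zero.2 (hxy i).symm
  refine tendsto_const_nhds.congr' ?_
  rcases hne.lt_or_gt with hlt | hlt
  · filter_upwards [(h2.sub h1).eventually_lt_const hlt, hN.eventually_ne_atTop 0] with a ha hNa
    rw [sign_sub_allocation d hNa, sign_neg hlt, sign_neg ha]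
  · filter_upwards [(h2.sub h1).eventually_const_lt hlt, hN.eventually_ne_atTop 0] with a ha hNa
    rw [sign_sub_allocation d hNa, sign_pos hlt, sign_pos ha]

/-- For two bins, whoever has more tokens in bin `0` has fewer in bin `1`, so that near a balanced
strategy no deviation of smaller order than `√n` matters. -/
lemma tendsto_tokenPayoff_zero_of_balanced [l.IsCountablyGenerated]
    {ξ η : (a : ι) → Allocation 2 (N a)} (d : Die 2) (hN : Tendsto N l atTop) {y : Deviation 2}
    (hξ : Tendsto (fun a => rescale d (ξ a)) l (𝓝 y))
    (hη : Tendsto (fun a => rescale d (η a)) l (𝓝 y))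
    (hy : argmaxProb d y.1 0 = argmaxProb d y.1 1) :
    Tendsto (fun a => tokenPayoff d (ξ a) (η a)) l (𝓝 0) := by
  have h := ((tendsto_lastBinProb_sup d hN hξ hη 0).sub
    (tendsto_lastBinProb_sup d hN hξ hη 1)).abs
  rw [sup_idem, hy, sub_self, abs_zero] at h
  refine squeeze_zero_norm (fun a => ?_) h
  have hs : ((η a).1 1 : ℝ) - (ξ a).1 1 = -(((η a).1 0 : ℝ) - (ξ a).1 0) := by
    have h1 := (ξ a).2
    have h2 := (η a).2
    rw [Fin.sum_univ_two] at h1 h2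
    have h3 : ((ξ a).1 0 : ℝ) + (ξ a).1 1 = N a := by exact_mod_cast h1
    have h4 : ((η a).1 0 : ℝ) + (η a).1 1 = N a := by exact_mod_cast h2
    linarith
  rw [tokenPayoff_eq, Fin.sum_univ_two, hs, Left.sign_neg, SignType.coe_neg, neg_mul,
    ← sub_eq_add_neg, ← mul_sub, Real.norm_eq_abs, abs_div, abs_mul]
  have hsgn : |((SignType.sign (((η a).1 0 : ℝ) - (ξ a).1 0) : SignType) : ℝ)| ≤ 1 := by
    rcases lt_trichotomy (((η a).1 0 : ℝ) - (ξ a).1 0) 0 with h | h | h <;> simp [h]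
  have := mul_le_of_le_one_left (abs_nonneg
    (lastBinProb d ((ξ a).1 ⊔ (η a).1) 0 - lastBinProb d ((ξ a).1 ⊔ (η a).1) 1)) hsgn
  rw [abs_two]
  linarith [abs_nonneg
    (lastBinProb d ((ξ a).1 ⊔ (η a).1) 0 - lastBinProb d ((ξ a).1 ⊔ (η a).1) 1)]

/-- A player who puts far too many tokens into one bin does not win in the limit. -/
lemma eventually_lt_tokenPayoff_of_tendsto_atTop [l.IsCountablyGenerated] (d : Die k)
    (hN : Tendsto N l atTop) {x : Deviation k} (hξ : Tendsto (fun a => rescale d (ξ a)) l (𝓝 x))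
    {j : Fin k} (hη : Tendsto (fun a => (rescale d (η a)).1 j) l atTop) {c : ℝ} (hc : c < 0) :
    ∀ᶠ a in l, c < tokenPayoff d (ξ a) (η a) := by
  have hx : ∀ i, Tendsto (fun a => (rescale d (ξ a)).1 i) l (𝓝 (x.1 i)) := fun i =>
    tendsto_pi_nhds.1 ((continuous_subtype_val.tendsto x).comp hξ) i
  have hsup : Tendsto (fun a =>
      ((((ξ a).1 ⊔ (η a).1) j : ℕ) - d.prob j * N a) / √(N a)) l atTop := by
    refine tendsto_atTop_mono (fun a => ?_) hη
    simp only [rescale, Pi.sup_apply]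
    gcongr
    exact le_max_right _ _
  have hlose : ∀ i, Tendsto (fun a => if i = j then 0 else
      if ((ξ a).1 ⊔ (η a).1) i = (ξ a).1 i then lastBinProb d ((ξ a).1 ⊔ (η a).1) i else 0) l
      (𝓝 0) := by
    intro i
    by_cases hij : i = j
    · simp only [hij, if_true]
      exact tendsto_const_nhds
    · simp only [hij, if_false]
      exact tendsto_lastBinProb_zero d hN (ζ := fun a => (ξ a).1 ⊔ (η a).1)
        (m := fun a => (ξ a).1 i) (Ne.symm hij) (hx i) hsup
  have hsum := (tendsto_finsetSum Finset.univ fun i _ => hlose i).neg.div_const 2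
  simp only [Finset.sum_const_zero, neg_zero, zero_div] at hsum
  filter_upwards [hsum.eventually_const_lt hc, hN.eventually_ne_atTop 0,
    hη.eventually_gt_atTop (x.1 j + 1), (hx j).eventually_lt_const (lt_add_one (x.1 j))]
    with a h1 h2 h3 h4
  refine h1.trans_le ?_
  rw [tokenPayoff_eq, ← Finset.sum_neg_distrib]
  gcongr with i _
  have hR := lastBinProb_nonneg d ((ξ a).1 ⊔ (η a).1) i
  by_cases hij : i = j
  · subst hij
    rw [if_pos rfl, sign_sub_allocation d h2, sign_pos (by linarith)]
    simpa using hR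
  · rw [if_neg hij]
    rcases lt_trichotomy ((η a).1 i : ℝ) ((ξ a).1 i) with h | h | h
    · have h5 : (η a).1 i < (ξ a).1 i := by exact_mod_cast h
      rw [if_pos (by simp [h5.le]), sign_neg (sub_neg.2 h)]
      simp
    · rw [h, sub_self, sign_zero]
      split_ifs <;> simp [hR]
    · rw [sign_pos (sub_pos.2 h)]
      split_ifs <;> simp [hR]

end TokenLimits

/-! ### A lower bound for integrals under weak convergence -/

/-- Let the images of `ν n` under `π n` converge weakly to `μ`. If the lower limit of `g n y` along
`n → ∞`, `π n y → x` is at least `f x` for almost every `x`, then `∫ f ∂μ` is at most any bound for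
the integrals `∫ g n ∂ν n`. The superlevel sets of `f` are exhausted by open sets on which `g n` is
eventually large; the open-set form of weak convergence, the layer cake formula and Fatou's lemma
then apply. -/
lemma integral_le_of_tendsto_of_forall_lt {X : Type*} [TopologicalSpace X] [MeasurableSpace X]
    [OpensMeasurableSpace X] [HasOuterApproxClosed X] {Y : ℕ → Type*}
    [∀ n, MeasurableSpace (Y n)] {ν : (n : ℕ) → ProbabilityMeasure (Y n)} {π : (n : ℕ) → Y n → X}
    (hπ : ∀ n, Measurable (π n)) {μ : ProbabilityMeasure X}
    (hμ : Tendsto (fun n => (ν n).map (hπ n).aemeasurable) atTop (𝓝 μ))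
    {g : (n : ℕ) → Y n → ℝ} (hgm : ∀ n, Measurable (g n)) (hg : ∀ n y, |g n y| ≤ 1)
    {f : X → ℝ} (hfm : Measurable f) (hf : ∀ x, |f x| ≤ 1)
    (hlow : ∀ᵐ x ∂(μ : Measure X), ∀ c < f x, ∀ᶠ s : Σ n, Y n in
      comap (fun s => (s.1, π s.1 s.2)) (atTop ×ˢ 𝓝 x), c < g s.1 s.2)
    {c₀ : ℝ} (hc₀ : ∀ n, ∫ y, g n y ∂(ν n : Measure (Y n)) ≤ c₀) :
    ∫ x, f x ∂(μ : Measure X) ≤ c₀ := by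
  set U : ℕ → ℝ → Set X := fun n₀ t =>
    interior {x | ∀ n ≥ n₀, ∀ y : Y n, π n y = x → t < g n y + 1} with hU
  have hUmono : ∀ t, Monotone fun n₀ => U n₀ t := fun t m n hmn =>
    interior_mono fun x hx n' hn' => hx n' (hmn.trans hn')
  have hlevel : ∀ t, (μ : Measure X) {x | t < f x + 1} ≤
      liminf (fun n => (ν n : Measure (Y n)) {y | t < g n y + 1}) atTop := by
    intro t
    have hsub : (μ : Measure X) {x | t < f x + 1} ≤ (μ : Measure X) (⋃ n₀, U n₀ t) := by
      refine measure_mono_ae ?_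
      filter_upwards [hlow] with x hx ht
      have ht' : t - 1 < f x := by
        have : t < f x + 1 := ht
        linarith
      obtain ⟨S, hS, hSsub⟩ := mem_comap.1 (hx _ ht')
      obtain ⟨A, hA, V, hV, hAV⟩ := mem_prod_iff.1 hS
      obtain ⟨n₀, hn₀⟩ := mem_atTop_sets.1 hA
      refine Set.mem_iUnion.2 ⟨n₀, mem_interior_iff_mem_nhds.2 (mem_of_superset hV ?_)⟩
      intro x' hx' n hn y hy
      have hmem : (⟨n, y⟩ : Σ n, Y n) ∈
          (fun s : Σ n, Y n => (s.1, π s.1 s.2)) ⁻¹' S :=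
        hAV (Set.mk_mem_prod (hn₀ n hn) (by rw [hy]; exact hx'))
      have : t - 1 < g n y := hSsub hmem
      linarith
    refine hsub.trans ?_
    rw [(hUmono t).measure_iUnion]
    refine iSup_le fun n₀ => ?_
    refine (ProbabilityMeasure.le_liminf_measure_open_of_tendsto hμ isOpen_interior).trans ?_
    refine liminf_le_liminf ?_
    filter_upwards [eventually_ge_atTop n₀] with n hn
    rw [ProbabilityMeasure.toMeasure_map, Measure.map_apply (hπ n) isOpen_interior.measurableSet]
    exact measure_mono fun y hy => interior_subset hy n hn y rfl
  have hf0 : ∀ x, 0 ≤ f x + 1 := fun x => by linarith [(abs_le.1 (hf x)).1]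
  have hg0 : ∀ n y, 0 ≤ g n y + 1 := fun n y => by linarith [(abs_le.1 (hg n y)).1]
  have hfi : Integrable f (μ : Measure X) :=
    .of_bound hfm.aestronglyMeasurable 1 (.of_forall hf)
  have hgi : ∀ n, Integrable (g n) (ν n : Measure (Y n)) := fun n =>
    .of_bound (hgm n).aestronglyMeasurable 1 (.of_forall (hg n))
  have hgint : ∀ n, ∫⁻ y, ENNReal.ofReal (g n y + 1) ∂(ν n : Measure (Y n)) ≤
      ENNReal.ofReal (c₀ + 1) := by
    intro n
    have hi : Integrable (fun y => g n y + 1) (ν n : Measure (Y n)) :=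
      (hgi n).add (integrable_const 1)
    rw [← ofReal_integral_eq_lintegral_ofReal hi (.of_forall (hg0 n)),
      integral_add (hgi n) (integrable_const 1)]
    refine ENNReal.ofReal_le_ofReal ?_
    simpa using hc₀ n
  have hmain : ENNReal.ofReal (∫ x, f x ∂(μ : Measure X) + 1) ≤ ENNReal.ofReal (c₀ + 1) := by
    have h1 : ∫ x, f x ∂(μ : Measure X) + 1 = ∫ x, (f x + 1) ∂(μ : Measure X) := by
      rw [integral_add hfi (integrable_const 1)]
      simp
    have hi : Integrable (fun x => f x + 1) (μ : Measure X) := hfi.add (integrable_const 1)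
    rw [h1, ofReal_integral_eq_lintegral_ofReal hi (.of_forall hf0),
      lintegral_eq_lintegral_meas_lt _ (.of_forall hf0)
      (hfm.add_const 1).aemeasurable]
    calc ∫⁻ t in Set.Ioi 0, (μ : Measure X) {x | t < f x + 1}
        ≤ ∫⁻ t in Set.Ioi (0 : ℝ),
            liminf (fun n => (ν n : Measure (Y n)) {y | t < g n y + 1}) atTop :=
          lintegral_mono fun t => hlevel t
      _ ≤ liminf (fun n => ∫⁻ t in Set.Ioi (0 : ℝ), (ν n : Measure (Y n)) {y | t < g n y + 1})
            atTop := by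
          refine lintegral_liminf_le fun n => Antitone.measurable fun s t hst => ?_
          exact measure_mono fun y hy => lt_of_le_of_lt hst hy
      _ ≤ ENNReal.ofReal (c₀ + 1) := by
          refine liminf_le_of_le (by isBoundedDefault) fun b hb => ?_
          obtain ⟨n, hn⟩ := hb.exists
          refine hn.trans ?_
          rw [← lintegral_eq_lintegral_meas_lt _ (.of_forall (hg0 n))
            ((hgm n).add_const 1).aemeasurable]
          exact hgint n
  have hc1 : 0 ≤ c₀ + 1 := by
    have h1 : ∫ y, (-1 : ℝ) ∂(ν 0 : Measure (Y 0)) ≤ ∫ y, g 0 y ∂(ν 0 : Measure (Y 0)) :=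
      integral_mono (integrable_const _) (hgi 0) fun y => (abs_le.1 (hg 0 y)).1
    simp at h1
    linarith [hc₀ 0]
  have := (ENNReal.ofReal_le_ofReal_iff hc1).1 hmain
  linarith

/-! ### Asymptotic optimality -/

/-- No mixed strategy beats itself, so its worst-case payoff is at most `0`. -/
lemma worstPayoff_nonpos {n : ℕ} (d : Die k) (α : ProbabilityMeasure (Allocation k n)) :
    worstPayoff d α ≤ 0 := by
  have hint : Integrable (fun z : Allocation k n × Allocation k n => tokenPayoff d z.1 z.2)
      ((α : Measure (Allocation k n)).prod α) :=
    .of_bound (measurable_of_countable _).aestronglyMeasurable 1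
      (.of_forall fun z => abs_tokenPayoff_le d _ _)
  have hswap := integral_integral_swap (f := fun ξ η => tokenPayoff d ξ η) hint
  have h1 : ∫ ξ, ∫ η, tokenPayoff d ξ η ∂(α : Measure (Allocation k n))
      ∂(α : Measure (Allocation k n)) =
      -∫ ξ, ∫ η, tokenPayoff d η ξ ∂(α : Measure (Allocation k n))
        ∂(α : Measure (Allocation k n)) := by
    rw [← integral_neg]
    refine integral_congr_ae (.of_forall fun ξ => ?_)
    beta_reduce
    rw [← integral_neg]
    exact integral_congr_ae (.of_forall fun η => tokenPayoff_swap d η ξ)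
  have h2 : ∫ η, tokenMixedPayoff d α η ∂(α : Measure (Allocation k n)) = 0 := by
    simp only [tokenMixedPayoff]
    linarith
  have h3 : ∫ _η, worstPayoff d α ∂(α : Measure (Allocation k n)) ≤
      ∫ η, tokenMixedPayoff d α η ∂(α : Measure (Allocation k n)) :=
    integral_mono (integrable_const _) hint.integral_prod_right fun η =>
      (worstPayoff_isLeast d α).2 ⟨η, rfl⟩
  rw [h2] at h3
  simpa using h3

section Limit

variable {d : Die k} {α : (n : ℕ) → ProbabilityMeasure (Allocation k n)}
  {α₀ : ProbabilityMeasure (Deviation k)} {N : ℕ → ℕ} {η : (n : ℕ) → Allocation k (N n)}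

lemma integral_le_of_tokenMixedPayoff_le
    (hα : Tendsto (fun n => rescaledStrategy d (α n)) atTop (𝓝 α₀)) (hN : Tendsto N atTop atTop)
    {c₀ : ℝ} (hc₀ : ∀ n, tokenMixedPayoff d (α (N n)) (η n) ≤ c₀) {f : Deviation k → ℝ}
    (hfm : Measurable f) (hf : ∀ x, |f x| ≤ 1)
    (hlow : ∀ᵐ x ∂(α₀ : Measure (Deviation k)), ∀ c < f x,
      ∀ᶠ s : Σ n, Allocation k (N n) in
        comap (fun s => (s.1, rescale d s.2)) (atTop ×ˢ 𝓝 x), c < tokenPayoff d s.2 (η s.1)) :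
    ∫ x, f x ∂(α₀ : Measure (Deviation k)) ≤ c₀ :=
  integral_le_of_tendsto_of_forall_lt (ν := fun n => α (N n)) (π := fun _ => rescale d)
    (fun _ => measurable_of_countable _) (hα.comp hN) (g := fun n ξ => tokenPayoff d ξ (η n))
    (fun _ => measurable_of_countable _) (fun n ξ => abs_tokenPayoff_le d ξ (η n)) hfm hf hlow hc₀

lemma tendsto_fst_comap_rescale (N : ℕ → ℕ) (x : Deviation k) :
    Tendsto (fun s : Σ n, Allocation k (N n) => s.1)
      (comap (fun s => (s.1, rescale d s.2)) (atTop ×ˢ 𝓝 x)) atTop :=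
  tendsto_fst.comp tendsto_comap

lemma tendsto_rescale_comap_rescale (N : ℕ → ℕ) (x : Deviation k) :
    Tendsto (fun s : Σ n, Allocation k (N n) => rescale d s.2)
      (comap (fun s => (s.1, rescale d s.2)) (atTop ×ˢ 𝓝 x)) (𝓝 x) :=
  tendsto_snd.comp tendsto_comap

/-- The token payoffs against allocations with limit `y` converge at almost every point of an
optimal strategy. For three or more bins, coordinates of `y` are avoided almost surely; for two
bins, the only possible tie is with an atom at `y`, where the strategy is balanced. -/
lemma IsOptimal.ae_tendsto_tokenPayoff (hα₀ : IsOptimal d α₀) (hN : Tendsto N atTop atTop)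
    {y : Deviation k} (hη : Tendsto (fun n => rescale d (η n)) atTop (𝓝 y)) :
    ∀ᵐ x ∂(α₀ : Measure (Deviation k)),
      Tendsto (fun s : Σ n, Allocation k (N n) => tokenPayoff d s.2 (η s.1))
        (comap (fun s => (s.1, rescale d s.2)) (atTop ×ˢ 𝓝 x)) (𝓝 (payoff d x y)) := by
  have hgen : ∀ x : Deviation k, (∀ i, x.1 i ≠ y.1 i) →
      Tendsto (fun s : Σ n, Allocation k (N n) => tokenPayoff d s.2 (η s.1))
        (comap (fun s => (s.1, rescale d s.2)) (atTop ×ˢ 𝓝 x)) (𝓝 (payoff d x y)) :=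
    fun x hx => tendsto_tokenPayoff d (N := fun s : Σ n, Allocation k (N n) => N s.1)
      (ξ := fun s => s.2) (η := fun s => η s.1) (hN.comp (tendsto_fst_comap_rescale N x))
      (tendsto_rescale_comap_rescale N x) (hη.comp (tendsto_fst_comap_rescale N x)) hx
  have hk := d.pos
  obtain rfl | rfl | hk3 : k = 1 ∨ k = 2 ∨ 3 ≤ k := by omega
  · refine .of_forall fun x => ?_
    have hx : x = y := by
      have h1 := x.2
      have h2 := y.2
      rw [Fin.sum_univ_one] at h1 h2
      ext i
      rw [Subsingleton.elim i 0, h1, h2]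
    have hs : ∀ s : Σ n, Allocation 1 (N n), tokenPayoff d s.2 (η s.1) = 0 := by
      intro s
      have : s.2 = η s.1 := by
        have h1 := s.2.2
        have h2 := (η s.1).2
        rw [Fin.sum_univ_one] at h1 h2
        ext i
        rw [Subsingleton.elim i 0, h1, h2]
      rw [this]
      simp [tokenPayoff]
    simp only [hs, hx, payoff_self]
    exact tendsto_const_nhds
  · have hne : ∀ x : Deviation 2, x ≠ y → ∀ i, x.1 i ≠ y.1 i := by
      intro x hxy i hi
      refine hxy ?_
      have h1 := x.2
      have h2 := y.2
      rw [Fin.sum_univ_two] at h1 h2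
      ext j
      fin_cases i <;> fin_cases j <;> simp at hi ⊢ <;> linarith
    by_cases hatom : (α₀ : Measure (Deviation 2)) {y} = 0
    · have hae : ∀ᵐ x ∂(α₀ : Measure (Deviation 2)), x ≠ y := by
        rw [ae_iff]
        simpa using hatom
      filter_upwards [hae] with x hx using hgen x (hne x hx)
    · refine .of_forall fun x => ?_
      by_cases hx : x = y
      · subst hx
        rw [payoff_self]
        exact tendsto_tokenPayoff_zero_of_balanced d
          (N := fun s : Σ n, Allocation 2 (N n) => N s.1) (ξ := fun s => s.2)
          (η := fun s => η s.1) (hN.comp (tendsto_fst_comap_rescale N x))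
          (tendsto_rescale_comap_rescale N x) (hη.comp (tendsto_fst_comap_rescale N x))
          (hα₀.argmaxProb_eq_of_atom hatom)
      · exact hgen x (hne x hx)
  · have hae : ∀ᵐ x ∂(α₀ : Measure (Deviation k)), ∀ i, x.1 i ≠ y.1 i :=
      ae_all_iff.2 fun i => by
        rw [ae_iff]
        simpa using hα₀.measure_coord_eq_zero hk3 i (y.1 i)
    filter_upwards [hae] with x hx using hgen x hx

lemma nonneg_of_tendsto_rescale (hα₀ : IsOptimal d α₀)
    (hα : Tendsto (fun n => rescaledStrategy d (α n)) atTop (𝓝 α₀)) (hN : Tendsto N atTop atTop)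
    {c₀ : ℝ} (hc₀ : ∀ n, tokenMixedPayoff d (α (N n)) (η n) ≤ c₀)
    {y : Deviation k} (hη : Tendsto (fun n => rescale d (η n)) atTop (𝓝 y)) : 0 ≤ c₀ := by
  refine (hα₀.integral_payoff_nonneg y).trans
    (integral_le_of_tokenMixedPayoff_le hα hN hc₀ (measurable_payoff_left d y)
      (fun x => abs_payoff_le d x y) ?_)
  filter_upwards [hα₀.ae_tendsto_tokenPayoff hN hη] with x hx c hc
  exact hx.eventually_const_lt hc

lemma nonneg_of_tendsto_atTop
    (hα : Tendsto (fun n => rescaledStrategy d (α n)) atTop (𝓝 α₀)) (hN : Tendsto N atTop atTop)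
    {c₀ : ℝ} (hc₀ : ∀ n, tokenMixedPayoff d (α (N n)) (η n) ≤ c₀)
    {j : Fin k} (hη : Tendsto (fun n => (rescale d (η n)).1 j) atTop atTop) : 0 ≤ c₀ := by
  have h := integral_le_of_tokenMixedPayoff_le hα hN hc₀ (f := fun _ => 0) measurable_const
    (by simp) (.of_forall fun x c hc =>
      eventually_lt_tokenPayoff_of_tendsto_atTop d
        (N := fun s : Σ n, Allocation k (N n) => N s.1) (ξ := fun s => s.2)
        (η := fun s => η s.1) (hN.comp (tendsto_fst_comap_rescale N x))
        (tendsto_rescale_comap_rescale N x) (hη.comp (tendsto_fst_comap_rescale N x)) hc)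
  simpa using h

/-- A sequence of deviations has a subsequence that converges or along which some coordinate tends
to `+∞`: as the coordinates add up to `0`, an upper bound for them all yields a lower bound. -/
lemma exists_subseq_tendsto_or_atTop (d : Die k) (y : ℕ → Deviation k) :
    ∃ φ : ℕ → ℕ, StrictMono φ ∧ ((∃ y₀, Tendsto (y ∘ φ) atTop (𝓝 y₀)) ∨
      ∃ j, Tendsto (fun n => (y (φ n)).1 j) atTop atTop) := by
  by_cases hb : ∃ C : ℝ, ∃ᶠ n in atTop, ∀ j, (y n).1 j ≤ C
  · obtain ⟨C, hC⟩ := hb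
    have hmem : ∃ᶠ n in atTop, (y n).1 ∈
        Set.Icc (fun _ : Fin k => C - k * C) (fun _ : Fin k => C) := by
      refine hC.mono fun n hn => ⟨fun j => ?_, hn⟩
      have h1 : ∑ i, (C - (y n).1 i) = k * C := by
        rw [Finset.sum_sub_distrib, (y n).2]
        simp
      have h2 := Finset.single_le_sum (f := fun i => C - (y n).1 i)
        (fun i _ => sub_nonneg.2 (hn i)) (Finset.mem_univ j)
      beta_reduce at h2 ⊢
      linarith
    obtain ⟨a, -, φ, hφ, ha⟩ := tendsto_subseq_of_frequently_bounded
      (Metric.isBounded_Icc _ _) hmem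
    have hsum : ∑ i, a i = 0 := by
      have h1 := tendsto_finsetSum Finset.univ fun i _ => tendsto_pi_nhds.1 ha i
      refine tendsto_nhds_unique h1 (tendsto_const_nhds.congr fun n => ?_)
      exact (y (φ n)).2.symm
    exact ⟨φ, hφ, Or.inl ⟨⟨a, hsum⟩, tendsto_subtype_rng.2 ha⟩⟩
  · push Not at hb
    have : Nonempty (Fin k) := ⟨⟨0, d.pos⟩⟩
    choose m hm using fun n => Finite.exists_max (y n).1
    have hmt : Tendsto (fun n => (y n).1 (m n)) atTop atTop := by
      refine tendsto_atTop.2 fun C => ?_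
      filter_upwards [hb C] with n hn
      obtain ⟨j, hj⟩ := hn
      exact hj.le.trans (hm n j)
    obtain ⟨j, hj⟩ : ∃ j, ∃ᶠ n in atTop, m n = j := by
      by_contra! hno
      have hall : ∀ᶠ n in atTop, ∀ j, ¬ m n = j :=
        eventually_all.2 hno
      obtain ⟨n, hn⟩ := hall.exists
      exact hn (m n) rfl
    obtain ⟨φ, hφ, hφj⟩ := extraction_of_frequently_atTop hj
    refine ⟨φ, hφ, Or.inr ⟨j, (hmt.comp hφ.tendsto_atTop).congr fun n => ?_⟩⟩
    simp only [Function.comp, hφj n]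

end Limit

end KnockEmDown

theorem corollary4p3 {k : ℕ} (d : KnockEmDown.Die k)
    (α : (n : ℕ) → ProbabilityMeasure (KnockEmDown.Allocation k n))
    (α₀ : ProbabilityMeasure (KnockEmDown.Deviation k))
    (hα₀ : KnockEmDown.IsOptimal d α₀)
    (hα : Tendsto (fun n => KnockEmDown.rescaledStrategy d (α n)) atTop (𝓝 α₀)) :
    KnockEmDown.IsAsymptoticallyOptimal d α := by
  open KnockEmDown in
  refine tendsto_order.2 ⟨fun c hc => ?_, fun c hc =>
    .of_forall fun n => (worstPayoff_nonpos d (α n)).trans_lt hc⟩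
  by_contra hno
  obtain ⟨N, hN, hNc⟩ := extraction_of_frequently_atTop (not_eventually.1 hno)
  choose η hη using fun n => (worstPayoff_isLeast d (α (N n))).1
  have hc₀ : ∀ n, tokenMixedPayoff d (α (N n)) (η n) ≤ c := fun n =>
    (hη n).trans_le (not_lt.1 (hNc n))
  obtain ⟨φ, hφ, ⟨y, hy⟩ | ⟨j, hj⟩⟩ := exists_subseq_tendsto_or_atTop d fun n => rescale d (η n)
  · exact hc.not_ge (nonneg_of_tendsto_rescale (N := N ∘ φ) (η := fun n => η (φ n)) hα₀ hα
      (hN.comp hφ).tendsto_atTop (fun n => hc₀ (φ n)) hy)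
  · exact hc.not_ge (nonneg_of_tendsto_atTop (N := N ∘ φ) (η := fun n => η (φ n)) hα
      (hN.comp hφ).tendsto_atTop (fun n => hc₀ (φ n)) hj)
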